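/- Conventions. For a commutative ring $A$ of characteristic $p>0$, let $A^\circ$ be the set of elements of $A$ lying in no minimal prime ideal, let ${}^eA$ be $A$ regarded as an $A$-algebra via the $e$-fold iterated Frobenius $x\mapsto x^{p^e}$, and for an $A$-module $M$ and $z\in M$ write $z^{q}$ (with $q=p^e$) for the image $z\otimes 1$ of $z$ in $M\otimes_A{}^eA$, on which $A$ acts through the factor ${}^eA$. Given ideals $\mathfrak b_1,\dots,\mathfrak b_k\subseteq A$ and real numbers $t_1,\dots,t_k>0$, let $0_M^{*\mathfrak b_1^{t_1}\cdots\mathfrak b_k^{t_k}}$ be the submodule of all $z\in M$ for which there is $c\in A^\circ$ with $c\,z^{q}\,\mathfrak b_1^{\lceil t_1q\rceil}\cdots\mathfrak b_k^{\lceil t_kq\rceil}=0$ in $M\otimes_A{}^eA$ for all sufficiently large $q=p^e$, and set $$\tau(A,\mathfrak b_1^{t_1}\cdots\mathfrak b_k^{t_k})=\bigcap_M\operatorname{Ann}_A\bigl(0_M^{*\mathfrak b_1^{t_1}\cdots\mathfrak b_k^{t_k}}\bigr),$$ where $M$ runs over all finitely generated $A$-modules. The ring $A$ is F-finite if its Frobenius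 endomorphism is finite. If $R$ is a regular local ring and $I\subset R$ is a prime ideal such that $S=R/I$ is normal, then $S$ is called $\mathbb Q$-Gorenstein if its canonical module $\omega_S=\operatorname{Ext}_R^{\operatorname{ht} I}(R/I,R)$ is torsion in the divisor class group of $S$, i.e. if, for an ideal $K\subseteq S$ isomorphic to $\omega_S$, some reflexive power $K^{(r)}=((K^r)^{-1})^{-1}$ with $r\ge 1$ is a principal fractional ideal. Statement. Let $(R,\mathfrak m)$ be an F-finite regular local ring of characteristic $p>0$ and $I\subset R$ a nonzero prime ideal such that $S=R/I$ is normal and $\mathbb Q$-Gorenstein. Let $\mathfrak a_1,\dots,\mathfrak a_k$ be ideals of $R$ and $t_1,\dots,t_k>0$ real numbers. Then, for every real number $t$ with $0<t<1$, $$\tau\bigl(S,(\mathfrak a_1S)^{t_1}\cdots(\mathfrak a_kS)^{t_k}\bigr)\subseteq\tau\bigl(R,I^t\mathfrak a_1^{t_1}\cdots\mathfrak a_k^{t_k}\bigr)S .$$ -/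

import Mathlib

open scoped TensorProduct nonZeroDivisors

universe u v

/-- A prime quotient of a ring of prime characteristic `p` again has characteristic `p`. -/
instance charP_quotient_of_isPrime {R : Type u} [CommRing R] {p : ℕ} [hp : Fact p.Prime] [CharP R p]
    (I : Ideal R) [hI : I.IsPrime] : CharP (R ⧸ I) p := by
  refine (CharP.charP_iff_prime_eq_zero hp.out).2 ?_
  rw [← map_natCast (Ideal.Quotient.mk I), CharP.cast_eq_zero, map_zero]

/-- A ring of characteristic `p` is F-finite if it is a finite module over itself via the
Frobenius endomorphism. -/
def IsFFinite (R : Type u) [CommRing R] (p : ℕ) [Fact p.Prime] [CharP R p] : Prop :=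
  (frobenius R p).Finite

/-- The ring `ᵉR`: the ring `R`, regarded as an `R`-algebra via the `e`-times iterated
Frobenius map `x ↦ x ^ (p ^ e)`. -/
def FrobeniusTwist (R : Type u) (_p _e : ℕ) : Type u := R

namespace FrobeniusTwist

instance (R : Type u) [CommRing R] (p e : ℕ) : CommRing (FrobeniusTwist R p e) :=
  inferInstanceAs (CommRing R)

/-- The identity map `R → ᵉR`, an isomorphism of rings (not of `R`-algebras). -/
def of (R : Type u) [CommRing R] (p e : ℕ) : R ≃+* FrobeniusTwist R p e := RingEquiv.refl R

noncomputable instance (R : Type u) [CommRing R] (p e : ℕ) [Fact p.Prime] [CharP R p] :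
    Algebra R (FrobeniusTwist R p e) :=
  ((of R p e).toRingHom.comp (iterateFrobenius R p e)).toAlgebra

theorem algebraMap_apply (R : Type u) [CommRing R] (p e : ℕ) [Fact p.Prime] [CharP R p] (x : R) :
    algebraMap R (FrobeniusTwist R p e) x = of R p e (x ^ p ^ e) := rfl

end FrobeniusTwist

/-- The set `R°` of elements of `R` lying in no minimal prime ideal of `R`. -/
def Ideal.minimalPrimesCompl (R : Type u) [CommRing R] : Set R :=
  {c | ∀ P ∈ minimalPrimes R, c ∉ P}

/-- The `𝔞₁^{t₁} ⋯ 𝔞ₖ^{tₖ}`-tight closure of a submodule `N` of an `R`-module `M`. Here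
`𝔽ᵉ(M) = ᵉR ⊗[R] M` with `R` acting through `ᵉR`, the element `c d z^q ∈ 𝔽ᵉ(M)` is `(c * d) ⊗ z`,
and `N.baseChange ᵉR` is the image `N^{[q]}_M` of `𝔽ᵉ(N) → 𝔽ᵉ(M)`. -/
noncomputable def tightClosure {R : Type u} [CommRing R] (p : ℕ) [Fact p.Prime] [CharP R p]
    {k : ℕ} (a : Fin k → Ideal R) (t : Fin k → ℝ)
    {M : Type v} [AddCommGroup M] [Module R M] (N : Submodule R M) : Submodule R M where
  carrier := {z | ∃ c ∈ Ideal.minimalPrimesCompl R, ∃ e₀ : ℕ, ∀ e ≥ e₀,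
    ∀ d ∈ ∏ i, a i ^ ⌈t i * (p : ℝ) ^ e⌉₊,
      FrobeniusTwist.of R p e (c * d) ⊗ₜ[R] z ∈ N.baseChange (FrobeniusTwist R p e)}
  zero_mem' := by
    refine ⟨1, fun P hP h => hP.1.1.ne_top ((Ideal.eq_top_iff_one P).2 h), 0, fun e _ d _ => ?_⟩
    rw [TensorProduct.tmul_zero]
    exact Submodule.zero_mem _
  add_mem' := by
    rintro x y ⟨c, hc, e₁, h₁⟩ ⟨c', hc', e₂, h₂⟩
    refine ⟨c * c', fun P hP h => (hP.1.1.mem_or_mem h).elim (hc P hP) (hc' P hP),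
      max e₁ e₂, fun e he d hd => ?_⟩
    rw [TensorProduct.tmul_add]
    refine Submodule.add_mem _ ?_ ?_
    · have := h₁ e (le_trans (le_max_left _ _) he) (c' * d) (Ideal.mul_mem_left _ _ hd)
      rwa [← mul_assoc] at this
    · have := h₂ e (le_trans (le_max_right _ _) he) (c * d) (Ideal.mul_mem_left _ _ hd)
      rwa [← mul_assoc, mul_comm c' c] at this
  smul_mem' := by
    rintro r x ⟨c, hc, e₀, h⟩
    refine ⟨c, hc, e₀, fun e he d hd => ?_⟩
    rw [TensorProduct.tmul_smul]
    have := Submodule.smul_mem _ (algebraMap R (FrobeniusTwist R p e) r) (h e he d hd)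
    rwa [algebraMap_smul] at this

/-- The generalized test ideal `τ(R, 𝔞₁^{t₁} ⋯ 𝔞ₖ^{tₖ})`: the intersection over all finitely
generated `R`-modules `M` of the annihilators of the `𝔞₁^{t₁} ⋯ 𝔞ₖ^{tₖ}`-tight closure of the
zero submodule of `M`. (Every finitely generated `R`-module is isomorphic to one in the universe
of `R`.) -/
noncomputable def testIdeal {R : Type u} [CommRing R] (p : ℕ) [Fact p.Prime] [CharP R p]
    {k : ℕ} (a : Fin k → Ideal R) (t : Fin k → ℝ) : Ideal R :=
  ⨅ (M : Type u) (_ : AddCommGroup M) (_ : Module R M) (_ : Module.Finite R M),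
    (tightClosure p a t (⊥ : Submodule R M)).annihilator

/-- Let `R` be a regular local ring and `I` a prime ideal of `R`. An ideal `K` of `S = R ⧸ I` is a
canonical ideal if it is isomorphic to the canonical module `ω_S = Ext^h_R(S, R)` of `S`, where
`h` is the height of `I`, i.e. `h = dim R - dim S`. (As `S` is a domain and `ω_S` is torsion-free
of rank one, canonical ideals exist. The height of `I` is finite as `R` is Noetherian. An
`R`-linear isomorphism between `S`-modules is `S`-linear.) -/
def IsCanonicalIdeal {R : Type u} [CommRing R] [IsRegularLocalRing R] (I : Ideal R)
    (K : Ideal (R ⧸ I)) : Prop :=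
  Nonempty (K ≃ₗ[R] CategoryTheory.Abelian.Ext (ModuleCat.of R (R ⧸ I)) (ModuleCat.of R R)
    I.height.toNat)

/-- Let `R` be a regular local ring and `I` a prime ideal such that the local domain `S = R ⧸ I` is
normal. Then `S` is ℚ-Gorenstein if its canonical class is torsion in the divisor class group:
for a canonical ideal `K`, some reflexive power `K^{(r)} = ((K^r)⁻¹)⁻¹` with `r ≥ 1` is
a principal fractional ideal. -/
def IsQGorensteinQuotient {R : Type u} [CommRing R] [IsRegularLocalRing R] (I : Ideal R)
    [I.IsPrime] : Prop :=
  ∃ K : Ideal (R ⧸ I), IsCanonicalIdeal I K ∧ ∃ r : ℕ, 0 < r ∧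
    ∃ x : FractionRing (R ⧸ I), x ≠ 0 ∧
      (((K : FractionalIdeal (R ⧸ I)⁰ (FractionRing (R ⧸ I))) ^ r)⁻¹)⁻¹ =
        FractionalIdeal.spanSingleton (R ⧸ I)⁰ x

/-! Write `q = p^e`, `J^[q]` for Frobenius powers, `n = τ(R, I^s 𝔞^t)`. Two properties of the
F-finite regular ring `R`, freeness of `ᵉR` and tight closedness of all ideals, give `I^⌈sq⌉ 𝔞^⌈tq⌉
⊆ n^[q]` (`prod_pow_ceil_le_frobeniusPower_testIdeal`).

Suppose `x` maps into `τ(S, 𝔞^t)` but `x ∉ n + I`. Then `x ∉ n + I + 𝔪^[p^E']` for some `E'`. As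
`R/𝔪^[p^E']` is Artinian Gorenstein, some `w` kills `n + I` but not `x` modulo `𝔪^[p^E']`. For `E ≥
E'` put `Z = 𝔪^[p^E]`, `L = Z : I`; a monomial `Y` embeds `R/𝔪^[p^E']` into `R/Z`, and `wY ∈ L`. The
finite `S`-module `M = L/Z ≅ Hom_R(S, R/Z)` and the class `z` of `wY` are the witnesses: if `𝔞^⌈tq⌉
z^q = 0` for large `q`, then `z` lies in the tight closure of zero, so `xz = 0` and `wx ∈ 𝔪^[p^E']`,
a contradiction.

For `d ∈ 𝔞^⌈tq⌉`, vanishing of `d z^q` follows from `d (wY)^q ∈ I L^[q] + Z^[q]`. By duality modulo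
`Z^[q]`, test this against a `u` killing the right side. Then `uI ⊆ I^[q] + Z^[q]`, and a perturbed
Briançon–Skoda argument (`Ideal.exists_mem_pow_ceil_sup_of_mul_mem`) yields `u ∈ I^⌈sq⌉ +
𝔪^[qp^E']`, with `E` independent of `q`. Here `s < 1` is essential: `u` is almost integral over
`I^(q-1)`, and the slack `(1-s)q` pays for all losses. So `ud ∈ n^[q] + 𝔪^[qp^E']`, which `w^q`
carries into `𝔪^[qp^E']` and `Y^q` then into `Z^[q]`. -/

/-! ### Regular local rings: domains, and regular systems of parameters -/

theorem WithBot.ENat.le_of_add_natCast_le_add_natCast {a b : WithBot ℕ∞} (n : ℕ)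
    (h : a + n ≤ b + n) : a ≤ b := by
  have h1 : (n : WithBot ℕ∞) ≠ WithBot.some ⊤ := by
    intro h
    exact ENat.natCast_ne_top n (WithBot.coe_injective h)
  exact (WithBot.add_le_add_iff_right' (α := ℕ) (WithBot.natCast_ne_bot n) h1).1 h

-- Induction on the number of generators. Killing `x ∈ 𝔪 \ 𝔪²` makes one generator redundant and
-- lowers the dimension by at most one, so `(x)` is prime. Prime avoidance lets `x` also avoid the
-- minimal primes; a minimal prime `P ⊆ (x)` then satisfies `P = xP`, and Nakayama gives `P = 0`.
open IsLocalRing in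
theorem isDomain_of_card_le_ringKrullDim (n : ℕ) : ∀ (R : Type u) [CommRing R] [IsLocalRing R]
    [IsNoetherianRing R] (s : Finset R), Ideal.span (s : Set R) = maximalIdeal R → s.card ≤ n →
    (n : WithBot ℕ∞) ≤ ringKrullDim R → IsDomain R := by
  classical
  induction n with
  | zero =>
    intro R _ _ _ s hs hc _
    have : s = ∅ := by simpa using hc
    have hm : maximalIdeal R = ⊥ := by rw [← hs, this]; simp
    exact (isField_iff_maximalIdeal_eq.2 hm).isDomain
  | succ n ih =>
    intro R _ _ _ s hs hc hd
    have hquot : ∀ x ∈ maximalIdeal R, x ∉ maximalIdeal R ^ 2 → (Ideal.span {x}).IsPrime := by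
      intro x hx hx2
      have hx1 : x ∈ Ideal.span (s : Set R) := hs ▸ hx
      obtain ⟨f, hf⟩ := (Submodule.mem_span_finset'.1 hx1)
      obtain ⟨i, hi⟩ : ∃ i, f i ∉ maximalIdeal R := by
        by_contra! hcon
        refine hx2 ?_
        rw [← hf, pow_two]
        exact Ideal.sum_mem _ fun i _ => Ideal.mul_mem_mul (hcon i) (hs ▸ Ideal.subset_span i.2)
      have hu : IsUnit (f i) := by simpa using hi
      let q := Ideal.Quotient.mk (Ideal.span {x})
      have hne : Ideal.span {x} ≠ ⊤ := by
        rw [Ne, Ideal.span_singleton_eq_top]; exact hx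
      have : Nontrivial (R ⧸ Ideal.span {x}) := Ideal.Quotient.nontrivial_iff.2 hne
      have : IsLocalRing (R ⧸ Ideal.span {x}) :=
        IsLocalRing.of_surjective' q Ideal.Quotient.mk_surjective
      have hmax : (maximalIdeal R).map q = maximalIdeal (R ⧸ Ideal.span {x}) :=
        IsLocalRing.map_maximalIdeal_of_surjective q Ideal.Quotient.mk_surjective
      have := ih (R ⧸ Ideal.span {x}) ((s.erase i).image q) ?_ ?_ ?_
      · exact (Ideal.Quotient.isDomain_iff_prime _).1 this
      · rw [← hmax, ← congrArg (Ideal.map q) hs, Finset.coe_image, ← Ideal.map_span]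
        refine le_antisymm (Ideal.map_mono (Ideal.span_mono (by simp))) ?_
        rw [Ideal.map_le_iff_le_comap, Ideal.span_le]
        intro z hz
        by_cases hzi : z = i
        · rw [hzi]
          have h0 : q x = 0 := Ideal.Quotient.eq_zero_iff_mem.2 (Ideal.mem_span_singleton_self x)
          have h0 : q (∑ a, f a • (a : R)) = 0 := by rw [hf]; exact h0
          rw [← Finset.add_sum_erase _ _ (Finset.mem_univ i), map_add, smul_eq_mul,
            map_mul] at h0
          have : q (f i) * q i ∈ Ideal.map q (Ideal.span ((s.erase (i : R) : Finset R) : Set R)) := by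
            rw [eq_neg_of_add_eq_zero_left h0, neg_mem_iff]
            refine Ideal.mem_map_of_mem _ (Ideal.sum_mem _ fun j hj => ?_)
            refine Ideal.mul_mem_left _ _ (Ideal.subset_span ?_)
            simp only [Finset.mem_erase, Finset.mem_univ, and_true] at hj
            simp [Subtype.coe_injective.ne hj]
          exact (Ideal.unit_mul_mem_iff_mem _ (hu.map q)).1 this
        · exact Ideal.mem_map_of_mem _ (Ideal.subset_span (by simp [hzi, Finset.mem_coe.1 hz]))
      · refine Finset.card_image_le.trans ?_
        rw [Finset.card_erase_of_mem i.2]; omega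
      · have h := ringKrullDim_le_ringKrullDim_quotient_add_encard ({x} : Set R) (by
          rw [IsLocalRing.ringJacobson_eq_maximalIdeal]; simpa using hx)
        have h2 := hd.trans h
        rw [Set.encard_singleton, Nat.cast_add] at h2
        exact WithBot.ENat.le_of_add_natCast_le_add_natCast 1 h2
    have hmin : (minimalPrimes R).Finite := minimalPrimes.finite_of_isNoetherianRing R
    have hex : ∃ x ∈ maximalIdeal R, x ∉ maximalIdeal R ^ 2 ∧ ∀ P ∈ minimalPrimes R, x ∉ P := by
      have hlt : ∀ P ∈ minimalPrimes R, ¬ maximalIdeal R ≤ P := by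
        intro P hP hle
        have hPm : maximalIdeal R = P :=
          (maximalIdeal.isMaximal R).eq_of_le hP.1.1.ne_top hle
        have h0 : (maximalIdeal R).height = 0 := by
          have : maximalIdeal R ∈ minimalPrimes R := hPm ▸ hP
          rw [Ideal.height_eq_zero_iff]; exact this
        rw [← maximalIdeal_height_eq_ringKrullDim, h0] at hd
        norm_cast at hd
      -- Prime avoidance tolerates the one non-prime ideal `𝔪²`.
      by_contra! hcon
      have hsub : (maximalIdeal R : Set R) ⊆
          ⋃ P ∈ insert (maximalIdeal R ^ 2) (minimalPrimes R), (P : Set R) := by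
        intro x hx
        by_cases hx2 : x ∈ maximalIdeal R ^ 2
        · exact Set.mem_biUnion (Set.mem_insert _ _) hx2
        · obtain ⟨P, hP, hxP⟩ := hcon x hx hx2
          exact Set.mem_biUnion (Set.mem_insert_of_mem _ hP) hxP
      obtain ⟨P, hP | hP, hle⟩ := (Ideal.subset_union_prime_finite (f := id) (hmin.insert _)
        (maximalIdeal R ^ 2) (maximalIdeal R ^ 2)
        (fun P hP h _ => (hP.resolve_left h).1.1)).1 hsub
      · have hbot : maximalIdeal R = ⊥ := by
          refine Submodule.eq_bot_of_le_smul_of_le_jacobson_bot (maximalIdeal R) _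
            (IsNoetherian.noetherian _) ?_ (IsLocalRing.maximalIdeal_le_jacobson _)
          rw [smul_eq_mul, ← pow_two, ← hP]
          exact hle
        obtain ⟨P, hP, -⟩ := Ideal.exists_minimalPrimes_le (bot_le : ⊥ ≤ maximalIdeal R)
        exact hlt P hP (hbot ▸ bot_le)
      · exact hlt P hP hle
    obtain ⟨x, hx, hx2, hxP⟩ := hex
    have hp := hquot x hx hx2
    obtain ⟨P, hP, hPx⟩ := Ideal.exists_minimalPrimes_le (bot_le : ⊥ ≤ Ideal.span {x})
    have hPp : P.IsPrime := hP.1.1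
    have hP0 : P = ⊥ := by
      refine Submodule.eq_bot_of_le_smul_of_le_jacobson_bot (maximalIdeal R) P
        (IsNoetherian.noetherian P) ?_ (IsLocalRing.maximalIdeal_le_jacobson _)
      intro y hy
      obtain ⟨z, rfl⟩ := Ideal.mem_span_singleton'.1 (hPx hy)
      rw [mul_comm]
      exact Submodule.smul_mem_smul hx ((hPp.mem_or_mem hy).resolve_right (hxP P hP))
    rw [hP0] at hPp
    exact IsDomain.of_bot_isPrime R

/-- A family of elements each of which is a nonzerodivisor modulo any subfamily avoiding it. -/
def IsPermutablyRegular {R : Type u} [CommRing R] {ι : Type v} (y : ι → R) : Prop :=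
  ∀ (T : Finset ι) (i : ι), i ∉ T → ∀ b, y i * b ∈ Ideal.span (y '' T) → b ∈ Ideal.span (y '' T)

-- Take a minimal generating set of `𝔪`. Modulo any subset of it the dimension drops by at most the
-- number of elements killed, so the quotient is again a domain by the previous criterion; by
-- minimality a remaining generator is nonzero there.
open IsLocalRing in
theorem IsRegularLocalRing.exists_isPermutablyRegular (R : Type u) [CommRing R]
    [IsRegularLocalRing R] :
    ∃ (d : ℕ) (y : Fin d → R), Ideal.span (Set.range y) = maximalIdeal R ∧
      IsPermutablyRegular y := by
  classical
  obtain ⟨s, hs_card, hs⟩ :=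
    Submodule.FG.exists_span_finset_card_eq_spanFinrank (IsNoetherian.noetherian (maximalIdeal R))
  have hdim := IsRegularLocalRing.spanFinrank_maximalIdeal (R := R)
  rw [← hs_card] at hdim
  change Ideal.span (s : Set R) = _ at hs
  refine ⟨s.card, fun i => s.equivFin.symm i, ?_, ?_⟩
  · rw [← hs]
    congr 1
    ext x
    constructor
    · rintro ⟨i, rfl⟩; exact (s.equivFin.symm i).2
    · intro hx; exact ⟨s.equivFin ⟨x, hx⟩, by simp⟩
  intro T i hi b hb
  set U : Finset R := T.image fun i => (s.equivFin.symm i : R) with hU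
  have hUim : (fun i => (s.equivFin.symm i : R)) '' T = (U : Set R) := by simp [hU]
  rw [hUim] at hb ⊢
  have hUs : U ⊆ s := by
    intro x hx
    obtain ⟨j, -, rfl⟩ := Finset.mem_image.1 hx
    exact (s.equivFin.symm j).2
  have hiU : (s.equivFin.symm i : R) ∉ U := by
    intro h
    obtain ⟨j, hj, hji⟩ := Finset.mem_image.1 h
    exact hi ((s.equivFin.symm.injective (Subtype.ext hji)) ▸ hj)
  clear_value U
  set x : R := (s.equivFin.symm i : R)
  have hxs : x ∈ s := (s.equivFin.symm i).2
  have hUm : Ideal.span (U : Set R) ≤ maximalIdeal R := hs ▸ Ideal.span_mono hUs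
  let q := Ideal.Quotient.mk (Ideal.span (U : Set R))
  have : Nontrivial (R ⧸ Ideal.span (U : Set R)) := Ideal.Quotient.nontrivial_iff.2
    fun h => (maximalIdeal.isMaximal R).ne_top (top_le_iff.1 (h ▸ hUm))
  have : IsLocalRing (R ⧸ Ideal.span (U : Set R)) :=
    IsLocalRing.of_surjective' q Ideal.Quotient.mk_surjective
  have hmax : (maximalIdeal R).map q = maximalIdeal _ :=
    IsLocalRing.map_maximalIdeal_of_surjective q Ideal.Quotient.mk_surjective
  have hdom : IsDomain (R ⧸ Ideal.span (U : Set R)) := by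
    refine isDomain_of_card_le_ringKrullDim (s.card - U.card) _ ((s \ U).image q) ?_ ?_ ?_
    · rw [← hmax, ← congrArg (Ideal.map q) hs, Finset.coe_image, ← Ideal.map_span]
      refine le_antisymm (Ideal.map_mono (Ideal.span_mono (by simp))) ?_
      rw [Ideal.map_le_iff_le_comap, Ideal.span_le]
      intro z hz
      by_cases hzU : z ∈ U
      · have : q z = 0 := Ideal.Quotient.eq_zero_iff_mem.2 (Ideal.subset_span hzU)
        rw [SetLike.mem_coe, Ideal.mem_comap, this]
        exact zero_mem _
      · exact Ideal.mem_map_of_mem _ (Ideal.subset_span (by simp [hzU, Finset.mem_coe.1 hz]))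
    · exact Finset.card_image_le.trans (Finset.card_sdiff_of_subset hUs).le
    · have h := ringKrullDim_le_ringKrullDim_quotient_add_encard (U : Set R) (by
        rw [IsLocalRing.ringJacobson_eq_maximalIdeal]
        exact fun z hz => hUm (Ideal.subset_span hz))
      have hcard := Finset.card_le_card hUs
      rw [← hdim, Set.encard_coe_eq_coe_finsetCard] at h
      have h2 : ((s.card - U.card : ℕ) : WithBot ℕ∞) + ((U.card : ℕ) : WithBot ℕ∞) ≤
          ringKrullDim (R ⧸ Ideal.span (U : Set R)) + ((U.card : ℕ) : WithBot ℕ∞) := by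
        rw [← Nat.cast_add, Nat.sub_add_cancel hcard]
        exact h
      exact WithBot.ENat.le_of_add_natCast_le_add_natCast U.card h2
  have hxU : x ∉ Ideal.span (U : Set R) := by
    intro hx
    have h1 : Ideal.span ((s.erase x : Finset R) : Set R) = maximalIdeal R := by
      refine le_antisymm (hs ▸ Ideal.span_mono (by simp)) ?_
      rw [← hs, Ideal.span_le]
      intro z hz
      by_cases hzx : z = x
      · rw [hzx]
        refine Ideal.span_mono ?_ hx
        intro w hw
        simp only [Finset.coe_erase, Set.mem_sdiff, Finset.mem_coe, Set.mem_singleton_iff]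
        exact ⟨hUs hw, fun h => hiU (h ▸ hw)⟩
      · exact Ideal.subset_span (by simp [hzx, Finset.mem_coe.1 hz])
    have h2 := Submodule.spanFinrank_span_le_ncard_of_finite (R := R) (s.erase x).finite_toSet
    rw [Set.ncard_coe_finset, Finset.card_erase_of_mem hxs] at h2
    change (Ideal.span _).spanFinrank ≤ _ at h2
    rw [h1, ← hs_card] at h2
    have := Finset.card_pos.2 ⟨x, hxs⟩
    omega
  have hprime := (Ideal.Quotient.isDomain_iff_prime _).1 hdom
  exact (hprime.mem_or_mem hb).resolve_left hxU

/-! ### Colon ideals of powers of a permutable regular sequence -/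

section PermutablyRegular

variable {R : Type u} [CommRing R] {ι : Type v}

theorem Ideal.mem_sup_span_pow_of_mul_mem (L : Ideal R) (x y : R)
    (hx : ∀ b, x * b ∈ L → b ∈ L)
    (hy : ∀ b, y * b ∈ L ⊔ Ideal.span {x} → b ∈ L ⊔ Ideal.span {x}) (n : ℕ) :
    ∀ b, y * b ∈ L ⊔ Ideal.span {x ^ n} → b ∈ L ⊔ Ideal.span {x ^ n} := by
  induction n with
  | zero => intro b _; simp
  | succ n ih =>
    intro b hb
    have hle : Ideal.span {x ^ (n + 1)} ≤ Ideal.span {x ^ n} :=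
      Ideal.span_singleton_le_span_singleton.2 (pow_dvd_pow x n.le_succ)
    obtain ⟨l, hl, w, hw, rfl⟩ := Submodule.mem_sup.1 (ih b (sup_le_sup_left hle L hb))
    obtain ⟨b', rfl⟩ := Ideal.mem_span_singleton'.1 hw
    obtain ⟨l', hl', w', hw', h⟩ := Submodule.mem_sup.1 hb
    obtain ⟨c, rfl⟩ := Ideal.mem_span_singleton'.1 hw'
    have hxn : ∀ m : ℕ, ∀ b, x ^ m * b ∈ L → b ∈ L := by
      intro m
      induction m with
      | zero => intro b hb; simpa using hb
      | succ m ihm => intro b hb; exact hx _ (ihm _ (by rwa [← mul_assoc, ← pow_succ]))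
    have h1 : y * b' - c * x ∈ L := by
      refine hxn n _ ?_
      have : x ^ n * (y * b' - c * x) = l' - y * l := by
        linear_combination -h
      rw [this]
      exact L.sub_mem hl' (L.mul_mem_left _ hl)
    have h2 : b' ∈ L ⊔ Ideal.span {x} := by
      refine hy _ ?_
      rw [show y * b' = (y * b' - c * x) + c * x by ring]
      exact Submodule.add_mem_sup h1 (Ideal.mul_mem_left _ _ (Ideal.mem_span_singleton_self x))
    obtain ⟨l2, hl2, w2, hw2, rfl⟩ := Submodule.mem_sup.1 h2
    obtain ⟨c2, rfl⟩ := Ideal.mem_span_singleton'.1 hw2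
    rw [show l + (l2 + c2 * x) * x ^ n = (l + l2 * x ^ n) + c2 * x ^ (n + 1) by ring]
    exact Submodule.add_mem_sup (L.add_mem hl (L.mul_mem_right _ hl2))
      (Ideal.mul_mem_left _ _ (Ideal.mem_span_singleton_self _))

/-- The ideal generated by the powers `y i ^ α i`, `i ∈ T`. -/
def powIdeal (y : ι → R) (α : ι → ℕ) (T : Finset ι) : Ideal R :=
  Ideal.span ((fun i => y i ^ α i) '' T)

theorem powIdeal_insert [DecidableEq ι] (y : ι → R) (α : ι → ℕ) (T : Finset ι) (k : ι) :
    powIdeal y α (insert k T) = powIdeal y α T ⊔ Ideal.span {y k ^ α k} := by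
  rw [powIdeal, powIdeal, Finset.coe_insert, Set.image_insert_eq, Ideal.span_insert, sup_comm]

theorem powIdeal_congr (y : ι → R) {α β : ι → ℕ} {T : Finset ι} (h : ∀ i ∈ T, α i = β i) :
    powIdeal y α T = powIdeal y β T := by
  rw [powIdeal, powIdeal]
  congr 1
  exact Set.image_congr fun i hi => by rw [h i hi]

theorem IsPermutablyRegular.mem_powIdeal_of_mul_mem {y : ι → R} (hy : IsPermutablyRegular y)
    (α : ι → ℕ) {T : Finset ι} {i : ι} (hi : i ∉ T) (b : R) (hb : y i * b ∈ powIdeal y α T) :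
    b ∈ powIdeal y α T := by
  classical
  -- First powers on `T₂` are allowed next to `α`-th powers on `T₁`, because raising `y k` to a
  -- power needs regularity modulo its first power.
  have key : ∀ T₁ T₂ : Finset ι, Disjoint T₁ T₂ → ∀ i, i ∉ T₁ → i ∉ T₂ → ∀ b,
      y i * b ∈ Ideal.span (y '' T₂) ⊔ powIdeal y α T₁ →
        b ∈ Ideal.span (y '' T₂) ⊔ powIdeal y α T₁ := by
    intro T₁
    induction T₁ using Finset.induction_on with
    | empty =>
      intro T₂ _ i _ hi b
      simpa [powIdeal] using hy T₂ i hi b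
    | insert k T hk ih =>
      intro T₂ hdisj i hi₁ hi₂ b
      rw [Finset.disjoint_insert_left] at hdisj
      rw [Finset.mem_insert, not_or] at hi₁
      rw [powIdeal_insert, ← sup_assoc]
      refine Ideal.mem_sup_span_pow_of_mul_mem _ _ _ (ih T₂ hdisj.2 k hk hdisj.1) ?_ (α k) b
      have := ih (insert k T₂) (Finset.disjoint_insert_right.2 ⟨hk, hdisj.2⟩) i hi₁.2
        (by simp [hi₁.1, hi₂])
      rw [Finset.coe_insert, Set.image_insert_eq, Ideal.span_insert] at this
      rwa [sup_assoc, sup_comm _ (Ideal.span {y k}), ← sup_assoc,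
        sup_comm (Ideal.span (y '' _)) (Ideal.span {y k})]
  have := key T ∅ (Finset.disjoint_empty_right T) i hi (Finset.notMem_empty i) b
  simp only [Finset.coe_empty, Set.image_empty, Ideal.span_empty, bot_sup_eq] at this
  exact this hb

theorem IsPermutablyRegular.mem_powIdeal_of_pow_mul_mem {y : ι → R} (hy : IsPermutablyRegular y)
    (α : ι → ℕ) {T : Finset ι} {i : ι} (hi : i ∉ T) (n : ℕ) (b : R)
    (hb : y i ^ n * b ∈ powIdeal y α T) : b ∈ powIdeal y α T := by
  induction n with
  | zero => simpa using hb
  | succ n ih =>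
    exact ih (hy.mem_powIdeal_of_mul_mem α hi _ (by rwa [← mul_assoc, ← pow_succ']))

variable [Fintype ι] [DecidableEq ι]

theorem powIdeal_univ (y : ι → R) (α : ι → ℕ) (k : ι) :
    powIdeal y α Finset.univ = powIdeal y α (Finset.univ.erase k) ⊔ Ideal.span {y k ^ α k} := by
  rw [← powIdeal_insert, Finset.insert_erase (Finset.mem_univ k)]

theorem IsPermutablyRegular.mem_powIdeal_of_mul_mem_add_single {y : ι → R}
    (hy : IsPermutablyRegular y) (δ : ι → ℕ) (k : ι) (b : R)
    (hb : y k * b ∈ powIdeal y (δ + Pi.single k 1) Finset.univ) :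
    b ∈ powIdeal y δ Finset.univ := by
  rw [powIdeal_univ y _ k] at hb ⊢
  have hcongr : powIdeal y (δ + Pi.single k 1) (Finset.univ.erase k) =
      powIdeal y δ (Finset.univ.erase k) :=
    powIdeal_congr y fun i hi => by simp [Finset.ne_of_mem_erase hi]
  rw [hcongr] at hb
  obtain ⟨l, hl, w, hw, h⟩ := Submodule.mem_sup.1 hb
  obtain ⟨c, rfl⟩ := Ideal.mem_span_singleton'.1 hw
  have h1 : b - c * y k ^ δ k ∈ powIdeal y δ (Finset.univ.erase k) := by
    refine hy.mem_powIdeal_of_mul_mem δ (Finset.notMem_erase k _) _ ?_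
    have : y k * (b - c * y k ^ δ k) = l := by
      have h2 : y k ^ (δ + Pi.single k 1 : ι → ℕ) k = y k ^ δ k * y k := by simp [pow_succ]
      rw [h2] at h
      linear_combination -h
    rwa [this]
  rw [show b = (b - c * y k ^ δ k) + c * y k ^ δ k by ring]
  exact Submodule.add_mem_sup h1 (Ideal.mul_mem_left _ _ (Ideal.mem_span_singleton_self _))

/-- Cancel the monomial one variable at a time, inducting on its total degree. -/
theorem IsPermutablyRegular.mem_powIdeal_of_prod_pow_mul_mem {y : ι → R}
    (hy : IsPermutablyRegular y) (δ β : ι → ℕ) (b : R)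
    (hb : (∏ i, y i ^ β i) * b ∈ powIdeal y (δ + β) Finset.univ) :
    b ∈ powIdeal y δ Finset.univ := by
  obtain ⟨n, hn⟩ : ∃ n, n = ∑ i, β i := ⟨_, rfl⟩
  induction n generalizing β b with
  | zero =>
    have h0 : β = 0 := by
      ext i
      exact Finset.sum_eq_zero_iff.1 hn.symm i (Finset.mem_univ i)
    simpa [h0] using hb
  | succ n ih =>
    obtain ⟨k, hk⟩ : ∃ k, β k ≠ 0 := by
      by_contra! h
      simp [h] at hn
    have hβ : β = (β - Pi.single k 1) + Pi.single k 1 := by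
      ext i
      by_cases hik : i = k
      · subst hik; simp; omega
      · simp [hik]
    set β' := β - Pi.single k 1
    rw [hβ] at hb hn
    refine ih β' b (hy.mem_powIdeal_of_mul_mem_add_single (δ + β') k _ ?_) ?_
    · rw [add_assoc]
      convert hb using 1
      simp only [Pi.add_apply, pow_add, Finset.prod_mul_distrib]
      have : ∏ i, y i ^ (Pi.single k 1 : ι → ℕ) i = y k := by
        rw [Finset.prod_eq_single k] <;> simp +contextual
      rw [this]
      ring
    · simp only [Pi.add_apply, Finset.sum_add_distrib, Finset.sum_pi_single',
        Finset.mem_univ, if_true] at hn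
      omega

theorem prod_pow_mul_mem_powIdeal (y : ι → R) (δ β : ι → ℕ) {b : R}
    (hb : b ∈ powIdeal y δ Finset.univ) :
    (∏ i, y i ^ β i) * b ∈ powIdeal y (δ + β) Finset.univ := by
  refine Submodule.span_induction (p := fun b _ => (∏ i, y i ^ β i) * b ∈ _)
    ?_ (by simp) ?_ ?_ hb
  · rintro _ ⟨i, -, rfl⟩
    rw [← Finset.mul_prod_erase _ _ (Finset.mem_univ i)]
    simp only
    rw [show y i ^ β i * (∏ j ∈ Finset.univ.erase i, y j ^ β j) * y i ^ δ i =
      (∏ j ∈ Finset.univ.erase i, y j ^ β j) * y i ^ (δ + β) i by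
        rw [Pi.add_apply, pow_add]; ring]
    exact Ideal.mul_mem_left _ _ (Ideal.subset_span ⟨i, by simp, rfl⟩)
  · intro a b _ _ ha hb; rw [mul_add]; exact Ideal.add_mem _ ha hb
  · intro r a _ ha; rw [smul_eq_mul, mul_left_comm]; exact Ideal.mul_mem_left _ _ ha

/-- The socle of `R ⧸ (yᵢ ^ (n + 1))` is generated by `∏ yᵢ ^ n`. -/
theorem IsPermutablyRegular.exists_sub_prod_pow_mul_mem {y : ι → R} (hy : IsPermutablyRegular y)
    (n : ℕ) {a : R} (ha : ∀ i, y i * a ∈ powIdeal y (fun _ => n + 1) Finset.univ) :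
    ∃ b, a - (∏ i, y i ^ n) * b ∈ powIdeal y (fun _ => n + 1) Finset.univ := by
  have key : ∀ T : Finset ι, ∃ b, a - (∏ i, y i ^ (if i ∈ T then n else 0)) * b ∈
      powIdeal y (fun _ => n + 1) Finset.univ := by
    intro T
    induction T using Finset.induction_on with
    | empty => exact ⟨a, by simp⟩
    | insert k T hk ih =>
      obtain ⟨b, hb⟩ := ih
      set β : ι → ℕ := fun i => if i ∈ T then n else 0
      -- Chosen so that `δ + e_k + β` is constantly `n + 1`. Cancelling the monomial `y^β` and then
      -- `y k` puts `b` in `(y^δ)`; its generator `y k ^ n` supplies the next factor, the others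
      -- vanish modulo the ideal after multiplication by `y^β`.
      set δ : ι → ℕ := fun i => if i = k then n else if i ∈ T then 1 else n + 1
      have hsum : (fun _ => n + 1 : ι → ℕ) = (δ + Pi.single k 1) + β := by
        ext i
        by_cases hik : i = k
        · subst hik; simp [δ, β, hk]
        · by_cases hiT : i ∈ T <;> simp [δ, β, hik, hiT, add_comm]
      have h1 : b ∈ powIdeal y δ Finset.univ := by
        refine hy.mem_powIdeal_of_mul_mem_add_single δ k b ?_
        refine hy.mem_powIdeal_of_prod_pow_mul_mem _ β _ ?_
        rw [← hsum]
        have := Ideal.sub_mem _ (ha k) (Ideal.mul_mem_left _ (y k) hb)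
        convert this using 1
        ring
      rw [powIdeal_univ y _ k] at h1
      obtain ⟨l, hl, w, hw, rfl⟩ := Submodule.mem_sup.1 h1
      obtain ⟨c, rfl⟩ := Ideal.mem_span_singleton'.1 hw
      refine ⟨c, ?_⟩
      have h2 : (∏ i, y i ^ β i) * l ∈ powIdeal y (fun _ => n + 1) Finset.univ := by
        rw [hsum]
        refine prod_pow_mul_mem_powIdeal y _ β ?_
        rw [powIdeal_univ y _ k]
        refine Ideal.mem_sup_left ?_
        rwa [powIdeal_congr y (β := δ) fun i hi => by simp [Finset.ne_of_mem_erase hi]]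
      have h3 : (∏ i, y i ^ (if i ∈ insert k T then n else 0)) = (∏ i, y i ^ β i) * y k ^ n := by
        rw [← Finset.prod_erase_mul _ _ (Finset.mem_univ k),
          ← Finset.prod_erase_mul Finset.univ (fun i => y i ^ β i) (Finset.mem_univ k)]
        have : β k = 0 := by simp [β, hk]
        rw [this, pow_zero, mul_one]
        congr 1
        · refine Finset.prod_congr rfl fun i hi => ?_
          simp [β, Finset.ne_of_mem_erase hi]
        · simp
      have h4 : δ k = n := by simp [δ]
      rw [h3]
      rw [h4] at hb
      have := Ideal.add_mem _ hb h2
      convert this using 1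
      ring
  obtain ⟨b, hb⟩ := key Finset.univ
  exact ⟨b, by simpa using hb⟩

end PermutablyRegular

/-! ### Double annihilators in an Artinian local ring with principal socle -/

section DoubleAnnihilator

open IsLocalRing

variable {A : Type u} [CommRing A] [IsLocalRing A] [IsArtinianRing A]

/-- With `J' = J + (x)` and `𝔪J' ⊆ J`, multiplication by `x` embeds `ann J / ann J'` into the socle
`(σ)`, a quotient of `A/𝔪`. -/
theorem Ideal.length_annihilator_le_of_covBy {σ : A} (hσ : ∀ m ∈ maximalIdeal A, m * σ = 0)
    (hsoc : ∀ a : A, (∀ m ∈ maximalIdeal A, m * a = 0) → a ∈ Ideal.span {σ})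
    {J J' : Ideal A} (h : J ⋖ J') :
    Module.length A J.annihilator ≤ Module.length A J'.annihilator + 1 := by
  have hmJ : maximalIdeal A • J' ≤ J := by
    have h1 : J ≤ J ⊔ maximalIdeal A • J' := le_sup_left
    have h2 : J ⊔ maximalIdeal A • J' ≤ J' := sup_le h.le Submodule.smul_le_right
    rcases h.eq_or_eq h1 h2 with h3 | h3
    · exact h3 ▸ le_sup_right
    · exact absurd (Submodule.le_of_le_smul_of_le_jacobson_bot (IsNoetherian.noetherian J')
        (IsLocalRing.maximalIdeal_le_jacobson _) h3.ge) h.lt.not_ge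
  obtain ⟨x, hxJ', hxJ⟩ := SetLike.exists_of_lt h.lt
  have hsup : J ⊔ Ideal.span {x} = J' := by
    refine (h.eq_or_eq le_sup_left (sup_le h.le ?_)).resolve_left ?_
    · rwa [Ideal.span_singleton_le_iff_mem]
    · intro h3
      exact hxJ (h3 ▸ Ideal.mem_sup_right (Ideal.mem_span_singleton_self x))
  let f : J.annihilator →ₗ[A] Ideal.span {σ} :=
    LinearMap.codRestrict _ (LinearMap.lsmul A A x ∘ₗ J.annihilator.subtype) (by
      rintro ⟨a, ha⟩
      refine hsoc _ fun m hm => ?_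
      have : m * x ∈ J := hmJ (Submodule.smul_mem_smul hm hxJ')
      have := Submodule.mem_annihilator.1 ha _ this
      simp only [LinearMap.comp_apply, Submodule.subtype_apply, LinearMap.lsmul_apply,
        smul_eq_mul] at this ⊢
      rw [← this]; ring)
  have hle : J'.annihilator ≤ J.annihilator := Submodule.annihilator_mono h.le
  have hex : Function.Exact (Submodule.inclusion hle) f.rangeRestrict := by
    rintro ⟨a, ha⟩
    rw [← Subtype.coe_inj, ← Subtype.coe_inj]
    simp only [f, LinearMap.codRestrict_apply, LinearMap.comp_apply,
      Submodule.subtype_apply, LinearMap.lsmul_apply, smul_eq_mul, ZeroMemClass.coe_zero]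
    constructor
    · intro hax
      have hax : x * a = 0 := hax
      have : a ∈ J'.annihilator := by
        rw [← hsup, Submodule.mem_annihilator]
        intro z hz
        obtain ⟨j, hj, w, hw, rfl⟩ := Submodule.mem_sup.1 hz
        obtain ⟨c, rfl⟩ := Ideal.mem_span_singleton'.1 hw
        rw [smul_add, Submodule.mem_annihilator.1 ha j hj, smul_eq_mul]
        linear_combination c * hax
      exact ⟨⟨a, this⟩, rfl⟩
    · rintro ⟨⟨b, hb⟩, hba⟩
      have : b = a := congrArg Subtype.val hba
      have := Submodule.mem_annihilator.1 hb x hxJ'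
      subst b
      change x * a = 0
      rw [mul_comm]; exact this
  rw [Module.length_eq_add_of_exact _ _ (Submodule.inclusion_injective hle)
    f.surjective_rangeRestrict hex]
  gcongr
  refine (Module.length_le_of_injective _ (Submodule.subtype_injective _)).trans ?_
  have : Function.Surjective (Submodule.liftQ (maximalIdeal A)
      (LinearMap.toSpanSingleton A (Ideal.span {σ}) ⟨σ, Ideal.mem_span_singleton_self σ⟩) (by
        intro m hm
        rw [LinearMap.mem_ker]
        exact Subtype.ext (hσ m hm))) := by
    rintro ⟨w, hw⟩
    obtain ⟨c, rfl⟩ := Ideal.mem_span_singleton'.1 hw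
    exact ⟨Submodule.Quotient.mk c, rfl⟩
  refine (Module.length_le_of_surjective _ this).trans (le_of_eq ?_)
  rw [Module.length_eq_one_iff]
  exact isSimpleModule_iff_isCoatom.2 (maximalIdeal.isMaximal A).out

theorem Ideal.length_add_length_annihilator_le {σ : A} (hσ : ∀ m ∈ maximalIdeal A, m * σ = 0)
    (hsoc : ∀ a : A, (∀ m ∈ maximalIdeal A, m * a = 0) → a ∈ Ideal.span {σ})
    {J J' : Ideal A} (h : J ≤ J') :
    Module.length A J + Module.length A J.annihilator ≤
      Module.length A J' + Module.length A J'.annihilator := by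
  induction J using WellFoundedGT.induction with
  | ind J ih =>
    rcases h.eq_or_lt with rfl | hlt
    · rfl
    · obtain ⟨K, hK, hKJ'⟩ := exists_covBy_le_of_lt hlt
      refine le_trans ?_ (ih K hK.lt hKJ')
      have h1 := Ideal.length_annihilator_le_of_covBy hσ hsoc hK
      have h2 : Module.length A J + 1 ≤ Module.length A K := by
        refine Order.add_one_le_of_lt ?_
        rw [Module.length_submodule, Module.length_submodule]
        exact Submodule.height_strictMono hK.lt
      calc _ ≤ Module.length A J + (Module.length A K.annihilator + 1) := by gcongr
        _ = (Module.length A J + 1) + Module.length A K.annihilator := by ring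
        _ ≤ _ := by gcongr

/-- The function `J ↦ ℓ(J) + ℓ(ann J)` is monotone and equals `ℓ(A)` at both `⊥` and `⊤`, hence is
constant. So `J` and its double annihilator have equal length, and one contains the other. -/
theorem Ideal.annihilator_annihilator_of_socle {σ : A} (hσ : ∀ m ∈ maximalIdeal A, m * σ = 0)
    (hsoc : ∀ a : A, (∀ m ∈ maximalIdeal A, m * a = 0) → a ∈ Ideal.span {σ}) (J : Ideal A) :
    J.annihilator.annihilator = J := by
  have hsum : ∀ J : Ideal A, Module.length A J + Module.length A J.annihilator =
      Module.length A A := by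
    intro J
    refine le_antisymm ?_ ?_
    · refine (Ideal.length_add_length_annihilator_le hσ hsoc (le_top : J ≤ ⊤)).trans ?_
      have : (⊤ : Ideal A).annihilator = ⊥ := by
        rw [eq_bot_iff]
        intro a ha
        simpa using Submodule.mem_annihilator.1 ha 1 trivial
      rw [this]; simp
    · refine le_trans ?_ (Ideal.length_add_length_annihilator_le hσ hsoc (bot_le : ⊥ ≤ J))
      rw [Submodule.annihilator_bot]; simp
  have hle : J ≤ J.annihilator.annihilator := by
    intro x hx
    rw [Submodule.mem_annihilator]
    intro a ha
    rw [smul_eq_mul, mul_comm]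
    exact Submodule.mem_annihilator.1 ha x hx
  refine (hle.eq_or_lt.resolve_right fun hlt => ?_).symm
  have h1 := hsum J
  have h2 := hsum J.annihilator
  rw [← h1, add_comm] at h2
  have h3 := (WithTop.add_right_inj (Module.length_ne_top (R := A) (M := J.annihilator))).1
    h2
  have h4 := Submodule.height_strictMono hlt
  rw [← Module.length_submodule, ← Module.length_submodule] at h4
  exact h4.ne' h3

end DoubleAnnihilator

/-! ### Double colons modulo an `𝔪`-primary ideal -/

section DoubleColon

open IsLocalRing

variable {R : Type u} [CommRing R] [IsLocalRing R] [IsNoetherianRing R]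

theorem IsLocalRing.mem_of_forall_mul_mem {Z J : Ideal R} {N : ℕ} (hN : maximalIdeal R ^ N ≤ Z)
    (hZ : Z ≠ ⊤) {σ : R} (hσ : ∀ m ∈ maximalIdeal R, m * σ ∈ Z)
    (hsoc : ∀ a : R, (∀ m ∈ maximalIdeal R, m * a ∈ Z) → ∃ b, a - σ * b ∈ Z)
    (hJ : Z ≤ J) {x : R} (hx : ∀ a, (∀ j ∈ J, a * j ∈ Z) → a * x ∈ Z) : x ∈ J := by
  let q := Ideal.Quotient.mk Z
  have : Nontrivial (R ⧸ Z) := Ideal.Quotient.nontrivial_iff.2 hZ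
  have : IsLocalRing (R ⧸ Z) := IsLocalRing.of_surjective' q Ideal.Quotient.mk_surjective
  have hmax : (maximalIdeal R).map q = maximalIdeal (R ⧸ Z) :=
    IsLocalRing.map_maximalIdeal_of_surjective q Ideal.Quotient.mk_surjective
  have : IsArtinianRing (R ⧸ Z) := by
    rw [isArtinianRing_iff_isNilpotent_maximalIdeal]
    refine ⟨N, ?_⟩
    rw [← hmax, ← Ideal.map_pow, Ideal.zero_eq_bot, eq_bot_iff, Ideal.map_le_iff_le_comap]
    intro z hz
    exact Ideal.Quotient.eq_zero_iff_mem.2 (hN hz)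
  have hq : ∀ z, q z = 0 ↔ z ∈ Z := fun z => Ideal.Quotient.eq_zero_iff_mem
  have hann := Ideal.annihilator_annihilator_of_socle (σ := q σ) (by
    intro m hm
    rw [← hmax, Ideal.mem_map_iff_of_surjective q Ideal.Quotient.mk_surjective] at hm
    obtain ⟨m, hm, rfl⟩ := hm
    rw [← map_mul, hq]
    exact hσ m hm) (by
    intro a ha
    obtain ⟨a, rfl⟩ := Ideal.Quotient.mk_surjective a
    obtain ⟨b, hb⟩ := hsoc a fun m hm => by
      have := ha (q m) (hmax ▸ Ideal.mem_map_of_mem q hm)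
      rwa [← map_mul, hq] at this
    rw [← hq, map_sub, map_mul, sub_eq_zero] at hb
    rw [Ideal.mem_span_singleton']
    exact ⟨q b, by rw [mul_comm]; exact hb.symm⟩) (J.map q)
  have hxJ : q x ∈ J.map q := by
    rw [← hann, Submodule.mem_annihilator]
    intro a ha
    obtain ⟨a, rfl⟩ := Ideal.Quotient.mk_surjective a
    have : a * x ∈ Z := hx a fun j hj => by
      have := Submodule.mem_annihilator.1 ha (q j) (Ideal.mem_map_of_mem q hj)
      rw [smul_eq_mul] at this
      rwa [← hq, map_mul]
    rw [← hq, map_mul] at this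
    rw [smul_eq_mul, mul_comm]
    exact this
  rwa [Ideal.mem_quotient_iff_mem hJ] at hxJ

end DoubleColon

/-! ### Kunz: freeness of Frobenius on an F-finite regular local ring -/

section FrobeniusFree

open IsLocalRing

variable {R : Type u} [CommRing R] (p : ℕ) [Fact p.Prime] [CharP R p]

theorem iterateFrobenius_finite (hR : IsFFinite R p) (e : ℕ) : (iterateFrobenius R p e).Finite := by
  induction e with
  | zero => rw [iterateFrobenius_zero]; exact RingHom.Finite.id R
  | succ e ih =>
    rw [iterateFrobenius_add, iterateFrobenius_one]
    exact ih.comp hR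

theorem FrobeniusTwist.module_finite (hR : IsFFinite R p) (e : ℕ) :
    Module.Finite R (FrobeniusTwist R p e) := by
  have : ((FrobeniusTwist.of R p e).toRingHom.comp (iterateFrobenius R p e)).Finite :=
    (RingHom.Finite.of_surjective _ (FrobeniusTwist.of R p e).surjective).comp
      (iterateFrobenius_finite p hR e)
  exact this

theorem FrobeniusTwist.smul_of (e : ℕ) (r v : R) :
    r • FrobeniusTwist.of R p e v = FrobeniusTwist.of R p e (r ^ p ^ e * v) := by
  rw [Algebra.smul_def, FrobeniusTwist.algebraMap_apply, map_mul]

theorem exists_sum_smul_of_mem_span_image {ι : Type v} {y : ι → R} {T : Finset ι} {x : R}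
    (hx : x ∈ Ideal.span (y '' T)) : ∃ f : ι → R, x = ∑ i ∈ T, f i * y i := by
  classical
  rw [← Finset.coe_image] at hx
  rw [Finset.coe_image] at hx
  obtain ⟨f, hf⟩ := (Submodule.mem_span_image_finset_iff_exists_fun' R).1 hx
  exact ⟨f, by simpa using hf.symm⟩

/-- Relations among the `y i ^ q` are trivial: the last coefficient lies in the ideal of the other
powers, and moving its expansion across the tensor sign leaves a shorter relation. -/
theorem FrobeniusTwist.sum_tmul_eq_zero {ι : Type v} {y : ι → R} (hy : IsPermutablyRegular y)
    (J : Ideal R) (hyJ : ∀ i, y i ∈ J) (e : ℕ) (T : Finset ι) (m : ι → R)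
    (h : ∑ i ∈ T, y i ^ p ^ e * m i = 0) :
    ∑ i ∈ T, (⟨y i, hyJ i⟩ : J) ⊗ₜ[R] FrobeniusTwist.of R p e (m i) = 0 := by
  classical
  induction T using Finset.induction_on generalizing m with
  | empty => simp
  | insert k T hk ih =>
    rw [Finset.sum_insert hk] at h ⊢
    have h1 : m k ∈ powIdeal y (fun _ => p ^ e) T := by
      refine hy.mem_powIdeal_of_pow_mul_mem _ hk (p ^ e) _ ?_
      rw [eq_neg_of_add_eq_zero_left h, neg_mem_iff]
      exact Ideal.sum_mem _ fun i hi => Ideal.mul_mem_right _ _ (Ideal.subset_span ⟨i, hi, rfl⟩)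
    obtain ⟨f, hf⟩ := exists_sum_smul_of_mem_span_image h1
    have h2 := ih (fun i => m i + y k ^ p ^ e * f i) (by
      rw [hf, Finset.mul_sum, ← Finset.sum_add_distrib] at h
      rw [← h]
      exact Finset.sum_congr rfl fun i _ => by ring)
    rw [← h2, hf, map_sum, TensorProduct.tmul_sum, ← Finset.sum_add_distrib]
    refine Finset.sum_congr rfl fun i _ => ?_
    rw [map_add, TensorProduct.tmul_add, add_comm, mul_comm (f i), ← FrobeniusTwist.smul_of,
      ← FrobeniusTwist.smul_of, ← TensorProduct.smul_tmul, ← TensorProduct.smul_tmul]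
    congr 2
    exact Subtype.ext (mul_comm _ _)

/-- Local criterion: for a finitely presented module it suffices that `𝔪 ⊗ ᵉR → ᵉR` is injective,
which is a statement about relations among the `y i ^ q`. -/
theorem FrobeniusTwist.free [IsRegularLocalRing R] (hR : IsFFinite R p) (e : ℕ) :
    Module.Free R (FrobeniusTwist R p e) := by
  have := FrobeniusTwist.module_finite p hR e
  have := Module.finitePresentation_of_finite R (FrobeniusTwist R p e)
  apply Module.free_of_maximalIdeal_rTensor_injective
  obtain ⟨d, y, hspan, hy⟩ := IsRegularLocalRing.exists_isPermutablyRegular R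
  have hym : ∀ i, y i ∈ maximalIdeal R := fun i => hspan ▸ Ideal.subset_span ⟨i, rfl⟩
  have hrep : ∀ z : maximalIdeal R ⊗[R] FrobeniusTwist R p e, ∃ m : Fin d → R,
      z = ∑ i, (⟨y i, hym i⟩ : maximalIdeal R) ⊗ₜ[R] FrobeniusTwist.of R p e (m i) := by
    intro z
    induction z using TensorProduct.induction_on with
    | zero => exact ⟨0, by simp⟩
    | tmul x v =>
      obtain ⟨x, hx⟩ := x
      obtain ⟨v, rfl⟩ := (FrobeniusTwist.of R p e).surjective v
      have hx' := hx
      rw [← hspan] at hx'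
      obtain ⟨f, hf⟩ := exists_sum_smul_of_mem_span_image (T := Finset.univ) (x := x)
        (by simpa using hx')
      refine ⟨fun i => f i ^ p ^ e * v, ?_⟩
      have : (⟨x, hx⟩ : maximalIdeal R) = ∑ i, f i • (⟨y i, hym i⟩ : maximalIdeal R) := by
        apply Subtype.ext
        simp [hf]
      rw [this, TensorProduct.sum_tmul]
      refine Finset.sum_congr rfl fun i _ => ?_
      rw [TensorProduct.smul_tmul, FrobeniusTwist.smul_of]
    | add a b ha hb =>
      obtain ⟨m, rfl⟩ := ha
      obtain ⟨m', rfl⟩ := hb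
      exact ⟨m + m', by simp [TensorProduct.tmul_add, Finset.sum_add_distrib]⟩
  rw [injective_iff_map_eq_zero]
  intro z hz
  obtain ⟨m, rfl⟩ := hrep z
  refine FrobeniusTwist.sum_tmul_eq_zero p hy _ hym e _ m ?_
  have := congrArg (TensorProduct.lid R (FrobeniusTwist R p e)) hz
  simp only [map_sum, LinearMap.rTensor_tmul, Submodule.subtype_apply, TensorProduct.lid_tmul,
    FrobeniusTwist.smul_of, map_zero] at this
  rw [← map_sum] at this
  exact (FrobeniusTwist.of R p e).injective (this.trans (map_zero _).symm)

end FrobeniusFree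

/-! ### Frobenius powers and tight closedness of ideals -/

section FrobeniusPower

variable {R : Type u} [CommRing R] (p : ℕ) [Fact p.Prime] [CharP R p]

/-- The Frobenius power `J^[p ^ e]`. -/
def Ideal.frobeniusPower (e : ℕ) (J : Ideal R) : Ideal R := J.map (iterateFrobenius R p e)

variable {p}

theorem Ideal.pow_mem_frobeniusPower {e : ℕ} {J : Ideal R} {x : R} (hx : x ∈ J) :
    x ^ p ^ e ∈ J.frobeniusPower p e :=
  Ideal.mem_map_of_mem (iterateFrobenius R p e) hx

theorem Ideal.frobeniusPower_le_iff {e : ℕ} {J K : Ideal R} :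
    J.frobeniusPower p e ≤ K ↔ ∀ x ∈ J, x ^ p ^ e ∈ K :=
  Ideal.map_le_iff_le_comap

theorem Ideal.frobeniusPower_add (e e' : ℕ) (J : Ideal R) :
    J.frobeniusPower p (e + e') = (J.frobeniusPower p e').frobeniusPower p e := by
  rw [frobeniusPower, iterateFrobenius_add, ← Ideal.map_map]; rfl

theorem Ideal.frobeniusPower_le_pow (e : ℕ) (J : Ideal R) : J.frobeniusPower p e ≤ J ^ p ^ e :=
  Ideal.frobeniusPower_le_iff.2 fun _ hx => Ideal.pow_mem_pow hx _

variable {ι : Type v} {e : ℕ} (b : Module.Basis ι R (FrobeniusTwist R p e))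

/-- `J^[q]` is the expansion `J · ᵉR`, which for a free module is read off coordinatewise. -/
theorem Ideal.mem_frobeniusPower_iff_repr (J : Ideal R) (v : R) :
    v ∈ J.frobeniusPower p e ↔ ∀ l, b.repr (FrobeniusTwist.of R p e v) l ∈ J := by
  constructor
  · intro hv
    suffices h : ∀ a l, b.repr (FrobeniusTwist.of R p e (a * v)) l ∈ J by simpa using h 1
    refine Submodule.span_induction
      (p := fun v _ => ∀ a l, b.repr (FrobeniusTwist.of R p e (a * v)) l ∈ J)
      ?_ (by simp) ?_ ?_ hv
    · rintro _ ⟨x, hx, rfl⟩ a l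
      have : FrobeniusTwist.of R p e (a * iterateFrobenius R p e x) =
          x • FrobeniusTwist.of R p e a := by
        rw [FrobeniusTwist.smul_of, mul_comm]; rfl
      rw [this, map_smul, Finsupp.smul_apply, smul_eq_mul]
      exact J.mul_mem_right _ hx
    · intro x y _ _ hx hy a l
      rw [mul_add, map_add, map_add, Finsupp.add_apply]
      exact J.add_mem (hx a l) (hy a l)
    · intro r x _ hx a l
      rw [smul_eq_mul, ← mul_assoc]
      exact hx _ l
  · intro h
    have := b.linearCombination_repr (FrobeniusTwist.of R p e v)
    rw [Finsupp.linearCombination_apply, Finsupp.sum] at this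
    have h2 : v = ∑ l ∈ (b.repr (FrobeniusTwist.of R p e v)).support,
        (b.repr (FrobeniusTwist.of R p e v) l) ^ p ^ e * (FrobeniusTwist.of R p e).symm (b l) := by
      apply (FrobeniusTwist.of R p e).injective
      rw [map_sum]
      refine this.symm.trans (Finset.sum_congr rfl fun l _ => ?_)
      rw [← FrobeniusTwist.smul_of, RingEquiv.apply_symm_apply]
    rw [h2]
    exact Ideal.sum_mem _ fun l _ => Ideal.mul_mem_right _ _ (Ideal.pow_mem_frobeniusPower (h l))

/-- Flatness of Frobenius: `J^[q] : K^[q] ⊆ (J : K)^[q]`. -/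
theorem Ideal.mem_frobeniusPower_of_forall_mul_pow_mem (b : Module.Basis ι R (FrobeniusTwist R p e))
    {J K L : Ideal R} (hL : ∀ x, (∀ u ∈ K, x * u ∈ J) → x ∈ L) {v : R}
    (hv : ∀ u ∈ K, v * u ^ p ^ e ∈ J.frobeniusPower p e) : v ∈ L.frobeniusPower p e := by
  rw [Ideal.mem_frobeniusPower_iff_repr b]
  refine fun l => hL _ fun u hu => ?_
  have h := (Ideal.mem_frobeniusPower_iff_repr b _ _).1 (hv u hu) l
  rwa [mul_comm v, ← FrobeniusTwist.smul_of, map_smul, Finsupp.smul_apply, smul_eq_mul,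
    mul_comm u] at h

theorem FrobeniusTwist.mem_frobeniusPower_of_tmul_eq_zero
    (b : Module.Basis ι R (FrobeniusTwist R p e)) {M : Type*} [AddCommGroup M] [Module R M]
    {v : R} {z : M} (h : FrobeniusTwist.of R p e v ⊗ₜ[R] z = 0) {J : Ideal R}
    (hJ : ∀ x : R, x • z = 0 → x ∈ J) : v ∈ J.frobeniusPower p e := by
  rw [Ideal.mem_frobeniusPower_iff_repr b]
  intro l
  refine hJ _ ?_
  have := congrArg (fun w => TensorProduct.lid R M ((b.coord l).rTensor M w)) h
  simpa using this

theorem IsRegularLocalRing.isDomain (R : Type u) [CommRing R] [IsRegularLocalRing R] :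
    IsDomain R := by
  obtain ⟨s, hs_card, hs⟩ := Submodule.FG.exists_span_finset_card_eq_spanFinrank
    (IsNoetherian.noetherian (IsLocalRing.maximalIdeal R))
  refine isDomain_of_card_le_ringKrullDim s.card R s hs le_rfl ?_
  rw [hs_card, IsRegularLocalRing.spanFinrank_maximalIdeal]

theorem IsLocalRing.eq_zero_of_forall_mem_pow {R : Type u} [CommRing R] [IsLocalRing R]
    [IsNoetherianRing R] {c : R} {e₀ : ℕ} {q : ℕ → ℕ} (hq : ∀ e, e ≤ q e)
    (hc : ∀ e ≥ e₀, c ∈ maximalIdeal R ^ q e) : c = 0 := by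
  have := Ideal.iInf_pow_eq_bot_of_isLocalRing (maximalIdeal R) (maximalIdeal.isMaximal R).ne_top
  rw [← Submodule.mem_bot (R := R), ← this, Submodule.mem_iInf]
  intro n
  exact Ideal.pow_le_pow_right (((le_max_left n e₀)).trans (hq _)) (hc (max n e₀) (le_max_right _ _))

/-- Ideals of a regular local ring are tightly closed. -/
theorem Ideal.mem_of_forall_mul_pow_mem_frobeniusPower [IsRegularLocalRing R] (hR : IsFFinite R p)
    {J : Ideal R} {c u : R} (hc : c ≠ 0) (e₀ : ℕ)
    (h : ∀ e ≥ e₀, c * u ^ p ^ e ∈ J.frobeniusPower p e) : u ∈ J := by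
  by_contra hu
  -- If `u ∉ J` then `J : u ⊆ 𝔪`, so `c ∈ (J : u)^[q] ⊆ 𝔪^q` for all large `q`; Krull's intersection
  -- theorem gives `c = 0`.
  refine hc (IsLocalRing.eq_zero_of_forall_mem_pow (e₀ := e₀) (q := fun e => p ^ e)
    (fun e => (Nat.lt_pow_self (Fact.out : p.Prime).one_lt).le) fun e he => ?_)
  have := FrobeniusTwist.free p hR e
  refine Ideal.frobeniusPower_le_pow e _ (Ideal.mem_frobeniusPower_of_forall_mul_pow_mem
    (Module.Free.chooseBasis R (FrobeniusTwist R p e)) (J := J) (K := Ideal.span {u}) ?_ ?_)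
  · intro x hx
    rw [IsLocalRing.mem_maximalIdeal, mem_nonunits_iff]
    intro hxu
    exact hu ((Ideal.unit_mul_mem_iff_mem J hxu).1 (hx u (Ideal.mem_span_singleton_self u)))
  · intro w hw
    obtain ⟨r, rfl⟩ := Ideal.mem_span_singleton'.1 hw
    rw [mul_pow, mul_left_comm]
    exact Ideal.mul_mem_left _ _ (h e he)

end FrobeniusPower

/-! ### Test ideals contain Frobenius roots -/

section TestIdeal

/-- Rounding up commutes with scaling in the favourable direction: `⌈tqq'⌉ ≤ q'⌈tq⌉`. -/
theorem Ideal.pow_mem_prod_pow_ceil {R : Type u} [CommRing R] {p k : ℕ} (a : Fin k → Ideal R) (t : Fin k → ℝ) {e e' : ℕ}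
    {y : R} (hy : y ∈ ∏ i, a i ^ ⌈t i * (p : ℝ) ^ e⌉₊) :
    y ^ p ^ e' ∈ ∏ i, a i ^ ⌈t i * (p : ℝ) ^ (e + e')⌉₊ := by
  have h := Ideal.pow_mem_pow hy (p ^ e')
  rw [← Finset.prod_pow] at h
  have hle : ∏ i, (a i ^ ⌈t i * (p : ℝ) ^ e⌉₊) ^ p ^ e' ≤
      ∏ i, a i ^ ⌈t i * (p : ℝ) ^ (e + e')⌉₊ := Finset.prod_le_prod' fun i _ => ?_
  · exact hle h
  rw [← pow_mul]
  refine Ideal.pow_le_pow_right (Nat.ceil_le.2 ?_)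
  push_cast
  rw [pow_add, ← mul_assoc]
  exact mul_le_mul_of_nonneg_right (Nat.le_ceil _) (by positivity)

variable {R : Type u} [CommRing R] [IsRegularLocalRing R] {p : ℕ} [Fact p.Prime] [CharP R p]

/-- It suffices that the coordinates of `y` kill every `z` in a tight closure of zero, i.e. `y ∈
(ann z)^[q]`. Raising `y` to powers `q'` gives `c y^q' ∈ (ann z)^[qq']`, and `(ann z)^[q]` is
tightly closed. -/
theorem prod_pow_ceil_le_frobeniusPower_testIdeal (hR : IsFFinite R p) {k : ℕ}
    (a : Fin k → Ideal R) (t : Fin k → ℝ) (e : ℕ) :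
    ∏ i, a i ^ ⌈t i * (p : ℝ) ^ e⌉₊ ≤ (testIdeal p a t).frobeniusPower p e := by
  intro y hy
  have := FrobeniusTwist.free p hR
  have := IsRegularLocalRing.isDomain R
  rw [Ideal.mem_frobeniusPower_iff_repr (Module.Free.chooseBasis R (FrobeniusTwist R p e))]
  intro l
  rw [testIdeal]
  simp only [Submodule.mem_iInf, Submodule.mem_annihilator]
  intro M _ _ _ z hz
  obtain ⟨c, hc, e₀, h⟩ := hz
  have hc0 : c ≠ 0 := by
    rintro rfl
    exact hc ⊥ (by simp [IsDomain.minimalPrimes_eq_singleton_bot]) (zero_mem _)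
  rw [← LinearMap.toSpanSingleton_apply, ← LinearMap.mem_ker]
  set J : Ideal R := LinearMap.ker (LinearMap.toSpanSingleton R M z)
  refine (Ideal.mem_frobeniusPower_iff_repr _ J y).1 ?_ l
  refine Ideal.mem_of_forall_mul_pow_mem_frobeniusPower hR hc0 e₀ fun e' he' => ?_
  rw [← Ideal.frobeniusPower_add]
  have h0 := h (e' + e) (by omega) (y ^ p ^ e')
    (by rw [add_comm e' e]; exact Ideal.pow_mem_prod_pow_ceil a t hy)
  rw [Submodule.baseChange_bot, Submodule.mem_bot] at h0
  exact FrobeniusTwist.mem_frobeniusPower_of_tmul_eq_zero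
    (Module.Free.chooseBasis R (FrobeniusTwist R p (e' + e))) h0 fun x hx => hx

end TestIdeal

/-! ### A uniform Briançon–Skoda statement with an `𝔪`-adic error -/

section UniformBrianconSkoda

open IsLocalRing

variable {R : Type u} [CommRing R]

/-- The multiplier `c` settles the exponents `N ≤ n`, and the equation reduces larger ones.
Exponents are shifted by one so that the equation has positive degree even when `n = 0`. -/
theorem Ideal.mul_pow_mem_of_integral_equation {D : Ideal R} {n : ℕ} {u w : R} {a : ℕ → R}
    (hw : w ∈ D ^ (n + 1)) (ha : ∀ k < n, a k ∈ D ^ (n - k))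
    (h : u ^ (n + 1) = w - ∑ k ∈ Finset.range n, a k * u ^ (k + 1)) {c : R}
    (hc : c ∈ D ^ (n + 1)) (N : ℕ) : c * u ^ N ∈ D ^ N := by
  induction N using Nat.strong_induction_on with
  | _ N ih =>
    rcases le_or_gt N n with hN | hN
    · exact Ideal.mul_mem_right _ _ (Ideal.pow_le_pow_right (by omega) hc)
    · obtain ⟨M, rfl⟩ := Nat.exists_eq_add_of_lt hN
      have : c * u ^ (n + M + 1) = (c * u ^ M) * w -
          ∑ k ∈ Finset.range n, a k * (c * u ^ (M + k + 1)) := by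
        rw [show n + M + 1 = M + (n + 1) by omega, pow_add, h, mul_sub, mul_sub, Finset.mul_sum,
          Finset.mul_sum]
        congr 1
        · ring
        · exact Finset.sum_congr rfl fun k _ => by ring
      rw [this]
      refine Ideal.sub_mem _ ?_ (Ideal.sum_mem _ fun k hk => ?_)
      · rw [show n + M + 1 = M + (n + 1) by omega, pow_add]
        exact Ideal.mul_mem_mul (ih M (by omega)) hw
      · rw [Finset.mem_range] at hk
        rw [show n + M + 1 = (n - k) + (M + k + 1) by omega, pow_add]
        exact Ideal.mul_mem_mul (ha k hk) (ih _ (by omega))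

/-- The determinant trick with an error term. -/
theorem Ideal.exists_integral_equation [Nontrivial R] {n : ℕ} (g : Fin n → R) (A B : Ideal R) (u : R)
    (hu : ∀ i, u * g i ∈ A * Ideal.span (Set.range g) ⊔ B) :
    ∃ (v : R) (a : ℕ → R), (∀ i, v * g i ∈ B) ∧ (∀ k < n, a k ∈ A ^ (n - k)) ∧
      u ^ n = v - ∑ k ∈ Finset.range n, a k * u ^ k := by
  classical
  have h1 : ∀ i, ∃ c : Fin n → R, (∀ l, c l ∈ A) ∧ u * g i - ∑ l, c l * g l ∈ B := by
    intro i
    obtain ⟨x, hx, y, hy, hxy⟩ := Submodule.mem_sup.1 (hu i)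
    obtain ⟨c, hc, rfl⟩ := (Submodule.mem_ideal_smul_span_iff_exists_sum A g x).1 hx
    refine ⟨c, hc, ?_⟩
    rw [Finsupp.sum_fintype _ _ (by simp)] at hxy
    simp only [smul_eq_mul] at hxy
    rw [← hxy, add_sub_cancel_left]
    exact hy
  choose c hcA hcB using h1
  let M : Matrix (Fin n) (Fin n) R := Matrix.of c
  have hmon := M.charpoly_monic
  have hnat : M.charpoly.natDegree = n := by simp
  refine ⟨M.charpoly.eval u, M.charpoly.coeff, ?_, ?_, ?_⟩
  · intro i
    rw [Matrix.eval_charpoly]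
    have h2 : (Matrix.scalar (Fin n) u - M).det * g i =
        ((Matrix.scalar (Fin n) u - M).adjugate.mulVec
          ((Matrix.scalar (Fin n) u - M).mulVec g)) i := by
      rw [Matrix.mulVec_mulVec, Matrix.adjugate_mul, Matrix.smul_mulVec, Matrix.one_mulVec]
      rfl
    rw [h2]
    change ∑ l : Fin n, _ * _ ∈ B
    refine Ideal.sum_mem _ fun l _ => Ideal.mul_mem_left _ _ ?_
    have h3 : (Matrix.scalar (Fin n) u - M).mulVec g l = u * g l - ∑ j, c l j * g j := by
      rw [Matrix.sub_mulVec, Pi.sub_apply]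
      congr 1
      simp [Matrix.scalar_apply, Matrix.mulVec_diagonal]
    rw [h3]
    exact hcB l
  · intro k _
    have := Matrix.coeff_charpoly_mem_ideal_pow (M := M) (I := A) (fun i j => hcA i j) k
    rwa [Fintype.card_fin] at this
  · have h4 := Polynomial.eval_eq_sum_range (p := M.charpoly) u
    rw [hnat, Finset.sum_range_succ] at h4
    have h5 : M.charpoly.coeff n = 1 := by
      have := hmon.coeff_natDegree
      rwa [hnat] at this
    rw [h4, h5]
    ring

/-- Artin–Rees for `(f)`, followed by cancelling `f`. -/
theorem IsLocalRing.exists_mem_pow_sub_of_mul_mem_pow [IsDomain R] [IsNoetherianRing R]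
    (m : Ideal R) {f : R} (hf : f ≠ 0) :
    ∃ k : ℕ, ∀ N x, x * f ∈ m ^ N → x ∈ m ^ (N - k) := by
  obtain ⟨k, hk⟩ := Ideal.exists_pow_inf_eq_pow_smul m (Ideal.span {f})
  refine ⟨k, fun N x hx => ?_⟩
  rcases le_or_gt k N with hN | hN
  · have h1 : x * f ∈ m ^ (N - k) • Ideal.span {f} := by
      have h2 := (hk N hN).le ⟨by simpa using hx, Ideal.mem_span_singleton'.2 ⟨x, rfl⟩⟩
      exact Submodule.smul_mono le_rfl inf_le_right h2
    rw [smul_eq_mul] at h1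
    obtain ⟨z, hz, hzf⟩ := Ideal.mem_mul_span_singleton.1 h1
    exact mul_right_cancel₀ hf hzf ▸ hz
  · rw [Nat.sub_eq_zero_of_le hN.le, pow_zero, Ideal.one_eq_top]; trivial

variable (p : ℕ) [Fact p.Prime] [CharP R p]

-- Pigeonhole: a monomial of degree above `s.card * q` contains the `q`-th power of some generator.
open Pointwise in
theorem Ideal.pow_le_frobeniusPower_mul_pow (s : Finset R) (e N : ℕ) (hN : s.card * p ^ e < N) :
    Ideal.span (s : Set R) ^ N ≤
      (Ideal.span (s : Set R)).frobeniusPower p e * Ideal.span (s : Set R) ^ (N - p ^ e) := by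
  classical
  have hpow : Ideal.span (s : Set R) ^ N = Ideal.span ((s : Set R) ^ N) :=
    Submodule.span_pow (R := R) (A := R) _ N
  conv_lhs => rw [hpow]
  rw [Ideal.span_le]
  intro x hx
  rw [← Finset.coe_pow, Finset.mem_coe, Finset.mem_pow] at hx
  obtain ⟨f, rfl⟩ := hx
  rw [List.prod_ofFn]
  have hmem : ∀ i, (f i : R) ∈ Ideal.span (s : Set R) := fun i => Ideal.subset_span (f i).2
  obtain ⟨g, hg, hcard⟩ := Finset.exists_lt_card_fiber_of_mul_lt_card_of_maps_to
    (s := Finset.univ) (t := s) (f := fun i : Fin N => (f i : R)) (n := p ^ e)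
    (fun i _ => (f i).2) (by simpa using hN)
  set F := Finset.univ.filter fun i : Fin N => (f i : R) = g
  rw [← Finset.prod_mul_prod_compl F]
  have h1 : ∏ i ∈ F, (f i : R) = g ^ p ^ e * g ^ (F.card - p ^ e) := by
    rw [← pow_add, Nat.add_sub_cancel' hcard.le]
    exact Finset.prod_eq_pow_card fun i hi => (Finset.mem_filter.1 hi).2
  rw [h1, mul_assoc]
  refine Ideal.mul_mem_mul (Ideal.pow_mem_frobeniusPower (Ideal.subset_span hg)) ?_
  have h2 : N - p ^ e = (F.card - p ^ e) + Fᶜ.card := by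
    rw [Finset.card_compl, Fintype.card_fin]
    have : F.card ≤ N := by simpa using Finset.card_le_univ F
    omega
  rw [h2, pow_add]
  refine Ideal.mul_mem_mul (Ideal.pow_mem_pow (Ideal.subset_span hg) _) ?_
  rw [← Finset.prod_const]
  exact Ideal.prod_mem_prod fun i _ => hmem i

theorem Ideal.pow_le_frobeniusPower_pow (s : Finset R) (e M : ℕ) :
    Ideal.span (s : Set R) ^ ((M + s.card + 1) * p ^ e) ≤
      (Ideal.span (s : Set R) ^ M).frobeniusPower p e := by
  set J := Ideal.span (s : Set R) with hJ
  have hpos : 0 < p ^ e := pow_pos (Fact.out : p.Prime).pos e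
  have h : ∀ M, J ^ ((M + s.card + 1) * p ^ e) ≤
      (J.frobeniusPower p e) ^ M * J ^ ((s.card + 1) * p ^ e) := by
    intro M
    induction M with
    | zero => simp
    | succ M ih =>
      refine (Ideal.pow_le_frobeniusPower_mul_pow p s e _ ?_).trans ?_
      · exact Nat.mul_lt_mul_of_pos_right (by omega) hpos
      · rw [← hJ, show (M + 1 + s.card + 1) * p ^ e - p ^ e = (M + s.card + 1) * p ^ e by
          rw [show M + 1 + s.card + 1 = (M + s.card + 1) + 1 by omega, add_mul (M + s.card + 1),
            one_mul, Nat.add_sub_cancel], pow_succ', mul_assoc]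
        exact Ideal.mul_mono_right ih
  refine (h M).trans (Ideal.mul_le_left.trans (le_of_eq ?_))
  exact (Ideal.map_pow (iterateFrobenius R p e) J M).symm

variable {p}

/-- Multiplication into a perturbed Frobenius power `I^[q] + 𝔪^[qp^E]` forces membership in
`I^⌈sq⌉ + 𝔪^[qp^E']`, uniformly in `q = p ^ e`. -/
theorem Ideal.exists_mem_pow_ceil_sup_of_mul_mem [IsRegularLocalRing R] (hR : IsFFinite R p)
    {I : Ideal R} (hI : I ≠ ⊥) {s : ℝ} (hs0 : 0 < s) (hs1 : s < 1) (E' : ℕ) :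
    ∃ E ≥ E', ∃ e₀, ∀ e ≥ e₀, ∀ u : R,
      (∀ i ∈ I, u * i ∈ I.frobeniusPower p e ⊔ (maximalIdeal R).frobeniusPower p (e + E)) →
      u ∈ I ^ ⌈s * (p : ℝ) ^ e⌉₊ ⊔ (maximalIdeal R).frobeniusPower p (e + E') := by
  have := IsRegularLocalRing.isDomain R
  have hp1 : 1 < p := (Fact.out : p.Prime).one_lt
  set m := maximalIdeal R with hm
  obtain ⟨n, g, hg⟩ := Submodule.fg_iff_exists_fin_generating_family.1 (IsNoetherian.noetherian I)
  change Ideal.span (Set.range g) = I at hg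
  obtain ⟨f, hfI, hf0⟩ := Submodule.exists_mem_ne_zero_of_ne_bot hI
  obtain ⟨k, hk⟩ := IsLocalRing.exists_mem_pow_sub_of_mul_mem_pow m hf0
  obtain ⟨sm, hsm⟩ := IsNoetherian.noetherian m
  change Ideal.span (sm : Set R) = m at hsm
  -- Makes `𝔪^(Kq) ⊆ 𝔪^[qp^E']`, by pigeonhole.
  set K : ℕ := (sm.card + 2) * p ^ E' with hK
  -- `L(1-s) ≥ K+1` guarantees `L(q - ν - 2 - ⌈sq⌉) ≥ Kq` as soon as `q ≥ L(ν+3)`.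
  obtain ⟨L, hL⟩ := exists_nat_ge (((K : ℝ) + 1) / (1 - s))
  rw [div_le_iff₀ (by linarith)] at hL
  set c := I ⊔ m ^ L with hc
  obtain ⟨sc, hsc⟩ := IsNoetherian.noetherian c
  change Ideal.span (sc : Set R) = c at hsc
  set ν := sc.card
  -- In `E`, the term `L(n+1)` pushes the error `v` into `(𝔪^L)^((q-1)(n+1))`, `k` pays the
  -- Artin–Rees loss, and `E'` secures `E ≥ E'`.
  refine ⟨L * (n + 1) + k + E', by omega, L * (ν + 3) + (ν + 3), fun e he u hu => ?_⟩
  set E := L * (n + 1) + k + E'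
  set q := p ^ e with hq
  have heq : e ≤ q := (Nat.lt_pow_self hp1).le
  have hEQ : E ≤ p ^ E := (Nat.lt_pow_self hp1).le
  obtain ⟨v, a, hv, ha, hva⟩ := Ideal.exists_integral_equation g (I ^ (q - 1)) (m ^ (q * p ^ E)) u (by
    intro i
    have h1 : I ^ (q - 1) * Ideal.span (Set.range g) = I ^ q := by
      rw [hg, ← pow_succ, Nat.sub_add_cancel (by omega)]
    rw [h1]
    refine sup_le_sup (Ideal.frobeniusPower_le_pow e I) ?_
      (hu (g i) (hg ▸ Ideal.subset_span ⟨i, rfl⟩))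
    refine (Ideal.frobeniusPower_le_pow _ m).trans (le_of_eq ?_)
    rw [pow_add])
  have hvm : v ∈ m ^ (q * p ^ E - k) := by
    refine hk _ _ ?_
    obtain ⟨r, hr⟩ := (Submodule.mem_span_range_iff_exists_fun R).1 (hg ▸ hfI)
    rw [← hr, Finset.mul_sum]
    refine Ideal.sum_mem _ fun i _ => ?_
    rw [smul_eq_mul, mul_left_comm]
    exact Ideal.mul_mem_left _ _ (hv i)
  have hvc : v ∈ (c ^ (q - 1)) ^ (n + 1) := by
    have h1 : L * ((q - 1) * (n + 1)) ≤ q * p ^ E - k := by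
      have h2 : q * E ≤ q * p ^ E := Nat.mul_le_mul_left q hEQ
      have h3 : q * E = q * (L * (n + 1)) + q * k + q * E' := by simp only [E]; ring
      have h4 : k ≤ q * k := Nat.le_mul_of_pos_left k (by omega)
      have h5 : L * ((q - 1) * (n + 1)) ≤ q * (L * (n + 1)) := by
        calc L * ((q - 1) * (n + 1)) ≤ L * (q * (n + 1)) := by gcongr; omega
          _ = _ := by ring
      omega
    have h6 := Ideal.pow_le_pow_right h1 hvm
    rw [pow_mul] at h6
    rw [← pow_mul]
    exact Ideal.pow_right_mono le_sup_right _ h6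
  obtain ⟨x, hx, hx0⟩ := Submodule.exists_mem_ne_zero_of_ne_bot
    (show (c ^ (q - 1)) ^ (n + 1) ≠ ⊥ by
      have : c ≠ ⊥ := fun h => hI (le_bot_iff.1 (h ▸ le_sup_left))
      exact pow_ne_zero _ (pow_ne_zero _ this))
  -- Enlarging `I` to `c = I + 𝔪^L` absorbs `v`: after multiplication by `u` the equation is an
  -- honest integral equation over `c^(q-1)`.
  have hint := Ideal.mul_pow_mem_of_integral_equation (D := c ^ (q - 1)) (n := n) (u := u)
    (w := u * v) (a := a) (Ideal.mul_mem_left _ _ hvc)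
    (fun k hk => Ideal.pow_right_mono (Ideal.pow_right_mono le_sup_left _) _ (ha k hk))
    (by rw [pow_succ', hva, mul_sub, Finset.mul_sum]
        congr 1
        exact Finset.sum_congr rfl fun k _ => by ring) hx
  -- Tight closure form of Briançon–Skoda: `x u^q' ∈ c^((q-1)q') ⊆ (c^(q-ν-2))^[q']` for all `q'`.
  have huc : u ∈ c ^ (q - ν - 2) := by
    refine Ideal.mem_of_forall_mul_pow_mem_frobeniusPower hR hx0 0 fun e' _ => ?_
    have h1 := Ideal.pow_le_frobeniusPower_pow p sc e' (q - ν - 2)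
    rw [hsc] at h1
    refine h1 ?_
    rw [show q - ν - 2 + sc.card + 1 = q - 1 by change q - ν - 2 + ν + 1 = _; omega, pow_mul]
    exact hint _
  set A := ⌈s * (p : ℝ) ^ e⌉₊ with hA
  have hAlt : (A : ℝ) < s * q + 1 := by
    have := Nat.ceil_lt_add_one (a := s * (p : ℝ) ^ e) (by positivity)
    rw [hq]; push_cast; exact this
  have hqe : (L : ℝ) * (ν + 3) ≤ q := by
    have : L * (ν + 3) ≤ q := by omega
    exact_mod_cast this
  have hL1 : 1 ≤ L := by
    by_contra! h
    have : L = 0 := by omega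
    rw [this] at hL
    have : (0 : ℝ) ≤ K := Nat.cast_nonneg K
    push_cast at hL
    linarith
  have hmain : ((K * q : ℕ) : ℝ) ≤ L * ((q : ℝ) - ν - 2 - A) := by
    push_cast
    have h1 : (L : ℝ) * ((q : ℝ) - ν - 2 - A) ≥ L * ((1 - s) * q - (ν + 3)) :=
      mul_le_mul_of_nonneg_left (by linarith) (Nat.cast_nonneg L)
    have h2 : ((K : ℝ) + 1) * q ≤ L * (1 - s) * q := by gcongr
    nlinarith
  have hAq : A + ν + 2 ≤ q := by
    have h0 : (0 : ℝ) ≤ L * ((q : ℝ) - ν - 2 - A) := le_trans (Nat.cast_nonneg _) hmain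
    have h1 : (0 : ℝ) < L := by exact_mod_cast hL1
    have h2 := nonneg_of_mul_nonneg_right h0 h1
    have : (A : ℝ) + ν + 2 ≤ q := by linarith
    exact_mod_cast this
  have hB : K * q ≤ L * (q - ν - 2 - A) := by
    have : ((q - ν - 2 - A : ℕ) : ℝ) = (q : ℝ) - ν - 2 - A := by
      rw [Nat.cast_sub (by omega), Nat.cast_sub (by omega), Nat.cast_sub (by omega)]
      push_cast; ring
    rw [← this] at hmain
    exact_mod_cast hmain
  have h7 : u ∈ I ^ A ⊔ (m ^ L) ^ (q - ν - 2 - A) := by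
    rw [show q - ν - 2 = A + (q - ν - 2 - A) by omega] at huc
    exact Ideal.sup_pow_add_le_pow_sup_pow huc
  have h8 := Ideal.pow_le_frobeniusPower_pow p sm (e + E') 1
  rw [hsm, pow_one, show 1 + sm.card + 1 = sm.card + 2 by omega,
    show (sm.card + 2) * p ^ (e + E') = K * q by rw [hK, hq, pow_add]; ring] at h8
  have h9 : (m ^ L) ^ (q - ν - 2 - A) ≤ m.frobeniusPower p (e + E') := by
    rw [← pow_mul]
    exact (Ideal.pow_le_pow_right hB).trans h8
  exact sup_le_sup le_rfl h9 h7

end UniformBrianconSkoda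

/-! ### Gorenstein duality modulo Frobenius powers of `𝔪` -/

section Socle

open IsLocalRing

variable {R : Type u} [CommRing R] {p : ℕ} [Fact p.Prime] [CharP R p]

theorem frobeniusPower_eq_powIdeal {d : ℕ} {y : Fin d → R} {m : Ideal R}
    (hm : Ideal.span (Set.range y) = m) (E : ℕ) :
    m.frobeniusPower p E = powIdeal y (fun _ => p ^ E) Finset.univ := by
  rw [← hm, Ideal.frobeniusPower, Ideal.map_span, powIdeal, Finset.coe_univ, Set.image_univ,
    ← Set.range_comp]
  rfl

theorem Ideal.frobeniusPower_le_self (E : ℕ) (J : Ideal R) : J.frobeniusPower p E ≤ J :=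
  (J.frobeniusPower_le_pow E).trans
    (Ideal.pow_le_self (pow_pos (Fact.out : p.Prime).pos E).ne')

/-- `R ⧸ 𝔪^[p ^ E]` is Gorenstein: ideals are double annihilators. -/
theorem IsRegularLocalRing.mem_of_forall_mul_mem_frobeniusPower [IsRegularLocalRing R] (E : ℕ)
    {J : Ideal R} (hJ : (maximalIdeal R).frobeniusPower p E ≤ J) {x : R}
    (hx : ∀ a, (∀ j ∈ J, a * j ∈ (maximalIdeal R).frobeniusPower p E) →
      a * x ∈ (maximalIdeal R).frobeniusPower p E) : x ∈ J := by
  obtain ⟨d, y, hspan, hy⟩ := IsRegularLocalRing.exists_isPermutablyRegular R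
  obtain ⟨sm, hsm⟩ := IsNoetherian.noetherian (maximalIdeal R)
  change Ideal.span (sm : Set R) = _ at hsm
  have hN := Ideal.pow_le_frobeniusPower_pow p sm E 1
  rw [hsm, pow_one] at hN
  have hQ : p ^ E = (p ^ E - 1) + 1 := by
    have := pow_pos (Fact.out : p.Prime).pos E
    omega
  have hZ := frobeniusPower_eq_powIdeal (p := p) hspan E
  refine IsLocalRing.mem_of_forall_mul_mem hN ?_ (σ := ∏ i, y i ^ (p ^ E - 1)) ?_ ?_ hJ hx
  · exact ne_top_of_le_ne_top (maximalIdeal.isMaximal R).ne_top (Ideal.frobeniusPower_le_self E _)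
  · intro m hm
    have h1 : m ∈ powIdeal y (fun _ => 1) Finset.univ := by
      simpa [powIdeal, hspan] using hm
    have h2 := prod_pow_mul_mem_powIdeal y (fun _ => 1) (fun _ => p ^ E - 1) h1
    rw [mul_comm, hZ]
    convert h2 using 2
    ext i
    rw [Pi.add_apply]
    omega
  · intro a ha
    have h1 : ∀ i, y i * a ∈ powIdeal y (fun _ => p ^ E - 1 + 1) Finset.univ := by
      intro i
      rw [← hQ, ← hZ]
      exact ha _ (hspan ▸ Ideal.subset_span ⟨i, rfl⟩)
    have h2 := hy.exists_sub_prod_pow_mul_mem (p ^ E - 1) h1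
    rwa [← hQ, ← hZ] at h2

/-- Multiplication by `∏ yᵢ ^ (p ^ E - p ^ E')` embeds `R ⧸ 𝔪^[p ^ E']` into `R ⧸ 𝔪^[p ^ E]`,
compatibly with Frobenius. -/
theorem IsRegularLocalRing.exists_mul_mem_frobeniusPower_iff (R : Type u) [CommRing R] (p : ℕ)
    [Fact p.Prime] [CharP R p] [IsRegularLocalRing R] {E' E : ℕ} (h : E' ≤ E) :
    ∃ Y : R, (∀ b, Y * b ∈ (maximalIdeal R).frobeniusPower p E →
        b ∈ (maximalIdeal R).frobeniusPower p E') ∧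
      ∀ e, ∀ b ∈ (maximalIdeal R).frobeniusPower p (e + E'),
        Y ^ p ^ e * b ∈ (maximalIdeal R).frobeniusPower p (e + E) := by
  obtain ⟨d, y, hspan, hy⟩ := IsRegularLocalRing.exists_isPermutablyRegular R
  have hle : p ^ E' ≤ p ^ E := Nat.pow_le_pow_right (Fact.out : p.Prime).pos h
  refine ⟨∏ i, y i ^ (p ^ E - p ^ E'), fun b hb => ?_, fun e b hb => ?_⟩
  · rw [frobeniusPower_eq_powIdeal hspan] at hb ⊢
    refine hy.mem_powIdeal_of_prod_pow_mul_mem _ (fun _ => p ^ E - p ^ E') b ?_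
    convert hb using 2
    ext i
    rw [Pi.add_apply]
    omega
  · rw [frobeniusPower_eq_powIdeal hspan] at hb ⊢
    have h1 := prod_pow_mul_mem_powIdeal y _ (fun _ => (p ^ E - p ^ E') * p ^ e) hb
    rw [← Finset.prod_pow]
    simp only [← pow_mul]
    convert h1 using 2
    ext i
    rw [Pi.add_apply, pow_add, pow_add, mul_comm _ (p ^ e), ← mul_add, Nat.add_sub_cancel' hle]

theorem IsLocalRing.exists_notMem_sup_pow {R : Type u} [CommRing R] [IsLocalRing R]
    [IsNoetherianRing R] {J : Ideal R} {x : R} (hx : x ∉ J) : ∃ n, x ∉ J ⊔ maximalIdeal R ^ n := by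
  by_contra! h
  refine hx ?_
  have h1 := Ideal.iInf_pow_smul_eq_bot_of_isLocalRing (M := R ⧸ J) (maximalIdeal R)
    (maximalIdeal.isMaximal R).ne_top
  rw [← Ideal.Quotient.eq_zero_iff_mem, ← Submodule.mem_bot (R := R), ← h1, Submodule.mem_iInf]
  intro n
  obtain ⟨j, hj, w, hw, hjw⟩ := Submodule.mem_sup.1 (h n)
  have h2 : Ideal.Quotient.mk J x = w • (1 : R ⧸ J) := by
    rw [← hjw, map_add, Ideal.Quotient.eq_zero_iff_mem.2 hj, zero_add, Algebra.smul_def, mul_one]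
    rfl
  rw [h2]
  exact Submodule.smul_mem_smul hw trivial

end Socle

/-! ### Vanishing in the Frobenius pullback of `(Z : I)/Z` -/

section Torsion

variable {R : Type u} [CommRing R] {p : ℕ} [Fact p.Prime] [CharP R p]

theorem mk_mem_torsionBySet {I Z : Ideal R} {W : R} (hW : ∀ i ∈ I, W * i ∈ Z) :
    Ideal.Quotient.mk Z W ∈ Submodule.torsionBySet R (R ⧸ Z) I := by
  rw [Submodule.mem_torsionBySet_iff]
  rintro ⟨i, hi⟩
  change Ideal.Quotient.mk Z (i * W) = 0
  rw [Ideal.Quotient.eq_zero_iff_mem, mul_comm]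
  exact hW i hi

/-- By flatness `ᵉR ⊗ L` embeds in `ᵉR` with image `L^[q]`, so `d ⊗ W` is determined by `d W^q`; the
parts from `I L^[q]` and `Z^[q]` die in `ᵉS ⊗ L/Z`. -/
theorem FrobeniusTwist.mk_tmul_eq_zero {I Z : Ideal R} [I.IsPrime] (e : ℕ)
    [Module.Flat R (FrobeniusTwist R p e)] {L : Ideal R} (hL : ∀ v ∈ L, ∀ i ∈ I, v * i ∈ Z)
    (hZL : Z ≤ L) {W : R} (hW : W ∈ L) {d : R}
    (hd : d * W ^ p ^ e ∈ I * L.frobeniusPower p e ⊔ Z.frobeniusPower p e) :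
    FrobeniusTwist.of (R ⧸ I) p e (Ideal.Quotient.mk I d) ⊗ₜ[R ⧸ I]
      (⟨Ideal.Quotient.mk Z W, mk_mem_torsionBySet (hL W hW)⟩ :
        Submodule.torsionBySet R (R ⧸ Z) I) = 0 := by
  let M := Submodule.torsionBySet R (R ⧸ Z) I
  let z : L → M := fun v => ⟨Ideal.Quotient.mk Z v, mk_mem_torsionBySet (hL v v.2)⟩
  let Φ : FrobeniusTwist R p e ⊗[R] L →+ FrobeniusTwist (R ⧸ I) p e ⊗[R ⧸ I] M := TensorProduct.liftAddHom
    { toFun := fun a =>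
        { toFun := fun v => FrobeniusTwist.of (R ⧸ I) p e
            (Ideal.Quotient.mk I ((FrobeniusTwist.of R p e).symm a)) ⊗ₜ[R ⧸ I] z v
          map_zero' := by
            have : z 0 = 0 := Subtype.ext (map_zero _)
            rw [this, TensorProduct.tmul_zero]
          map_add' := fun v w => by
            have : z (v + w) = z v + z w := Subtype.ext (map_add _ _ _)
            rw [this, TensorProduct.tmul_add] }
      map_zero' := by ext v; simp
      map_add' := fun a b => by ext v; simp [TensorProduct.add_tmul] } (by
      intro r a v
      obtain ⟨a, rfl⟩ := (FrobeniusTwist.of R p e).surjective a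
      have h1 : z (r • v) = Ideal.Quotient.mk I r • z v := rfl
      simp only [AddMonoidHom.coe_mk, ZeroHom.coe_mk, FrobeniusTwist.smul_of,
        RingEquiv.symm_apply_apply, h1]
      rw [← TensorProduct.smul_tmul, FrobeniusTwist.smul_of, map_mul, map_pow])
  have hΦ : ∀ a v, Φ (FrobeniusTwist.of R p e a ⊗ₜ v) =
      FrobeniusTwist.of (R ⧸ I) p e (Ideal.Quotient.mk I a) ⊗ₜ[R ⧸ I] z v := fun a v => rfl
  let μ : FrobeniusTwist R p e ⊗[R] L →ₗ[R] FrobeniusTwist R p e :=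
    (TensorProduct.rid R (FrobeniusTwist R p e)).toLinearMap ∘ₗ (Submodule.subtype L).lTensor (FrobeniusTwist R p e)
  have hμ : ∀ a (v : L), μ (FrobeniusTwist.of R p e a ⊗ₜ v) =
      FrobeniusTwist.of R p e (a * (v : R) ^ p ^ e) := by
    intro a v
    simp only [μ, LinearMap.comp_apply, LinearMap.lTensor_tmul, LinearEquiv.coe_coe,
      TensorProduct.rid_tmul, Submodule.subtype_apply, FrobeniusTwist.smul_of, mul_comm a]
  have hμinj : Function.Injective μ := (TensorProduct.rid R (FrobeniusTwist R p e)).injective.comp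
    (Module.Flat.lTensor_preserves_injective_linearMap _ (Submodule.subtype_injective L))
  -- Quantifying over all multipliers `a` makes `T` an ideal although `Φ` is only additive.
  let T : Ideal R :=
    { carrier := {w | ∀ a, ∃ ξ, μ ξ = FrobeniusTwist.of R p e (a * w) ∧ Φ ξ = 0}
      zero_mem' := fun a => ⟨0, by simp, by simp⟩
      add_mem' := by
        intro w w' h h' a
        obtain ⟨ξ, h1, h2⟩ := h a
        obtain ⟨ξ', h1', h2'⟩ := h' a
        exact ⟨ξ + ξ', by rw [map_add, h1, h1', mul_add, map_add], by rw [map_add, h2, h2', add_zero]⟩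
      smul_mem' := by
        intro r w h a
        obtain ⟨ξ, h1, h2⟩ := h (a * r)
        exact ⟨ξ, by rw [h1, smul_eq_mul, mul_assoc], h2⟩ }
  have hT : I * L.frobeniusPower p e ⊔ Z.frobeniusPower p e ≤ T := by
    refine sup_le (Ideal.mul_le.2 fun i hi v hv => ?_) (Ideal.frobeniusPower_le_iff.2 ?_)
    · have : L.frobeniusPower p e ≤ Submodule.comap (LinearMap.mulLeft R i) T := by
        refine Ideal.frobeniusPower_le_iff.2 fun v hv a => ?_
        refine ⟨FrobeniusTwist.of R p e (a * i) ⊗ₜ ⟨v, hv⟩, ?_, ?_⟩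
        · rw [hμ, LinearMap.mulLeft_apply, mul_assoc]
        · rw [hΦ, Ideal.Quotient.eq_zero_iff_mem.2 (I.mul_mem_left a hi), map_zero,
            TensorProduct.zero_tmul]
      exact this hv
    · intro v hv a
      refine ⟨FrobeniusTwist.of R p e a ⊗ₜ ⟨v, hZL hv⟩, hμ _ _, ?_⟩
      have : z ⟨v, hZL hv⟩ = 0 := Subtype.ext (Ideal.Quotient.eq_zero_iff_mem.2 hv)
      rw [hΦ, this, TensorProduct.tmul_zero]
  obtain ⟨ξ, h1, h2⟩ := hT hd 1
  rw [one_mul, ← hμ d ⟨W, hW⟩] at h1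
  rw [hμinj h1] at h2
  exact h2

end Torsion

/-! ### The restriction argument -/

section Restriction

open IsLocalRing

variable {R : Type u} [CommRing R] [IsRegularLocalRing R] {p : ℕ} [Fact p.Prime] [CharP R p]

/-- With `Z = 𝔪^[p ^ E]`, `L = Z : I` and `q = p ^ e`: if `I^A c ⊆ n^[q]` and `w` is annihilated
by `n` modulo `𝔪^[p ^ E']`, then `c` kills the `q`-th power of the class of `w Y` in `L ⧸ Z`. -/
theorem mul_pow_mem_of_le_frobeniusPower (hR : IsFFinite R p) {I n c : Ideal R} {A E E' e : ℕ}
    (hc : I ^ A * c ≤ n.frobeniusPower p e)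
    (hu : ∀ u : R, (∀ i ∈ I, u * i ∈ I.frobeniusPower p e ⊔
      (maximalIdeal R).frobeniusPower p (e + E)) →
      u ∈ I ^ A ⊔ (maximalIdeal R).frobeniusPower p (e + E'))
    {w Y : R} (hw : ∀ j ∈ n, w * j ∈ (maximalIdeal R).frobeniusPower p E')
    (hY : ∀ b ∈ (maximalIdeal R).frobeniusPower p (e + E'),
      Y ^ p ^ e * b ∈ (maximalIdeal R).frobeniusPower p (e + E))
    {L : Ideal R}
    (hL : ∀ v, (∀ i ∈ I, v * i ∈ (maximalIdeal R).frobeniusPower p E) → v ∈ L)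
    {d : R} (hd : d ∈ c) :
    d * (w * Y) ^ p ^ e ∈ I * L.frobeniusPower p e ⊔
      ((maximalIdeal R).frobeniusPower p E).frobeniusPower p e := by
  rw [← Ideal.frobeniusPower_add]
  refine IsRegularLocalRing.mem_of_forall_mul_mem_frobeniusPower (e + E) le_sup_right fun u hau => ?_
  have hfree := FrobeniusTwist.free p hR e
  have h1 : ∀ i ∈ I, u * i ∈ I.frobeniusPower p e ⊔
      (maximalIdeal R).frobeniusPower p (e + E) := by
    intro i hi
    refine IsRegularLocalRing.mem_of_forall_mul_mem_frobeniusPower (e + E) le_sup_right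
      fun a ha => ?_
    -- Second use of duality: an `a` killing `I^[q]` modulo `Z^[q]` lies in `L^[q]`, and `u` kills
    -- `I L^[q]` modulo `Z^[q]`.
    have haL : a ∈ L.frobeniusPower p e := by
      refine Ideal.mem_frobeniusPower_of_forall_mul_pow_mem
        (Module.Free.chooseBasis R (FrobeniusTwist R p e))
        (J := (maximalIdeal R).frobeniusPower p E) (K := I) hL fun x hx => ?_
      rw [← Ideal.frobeniusPower_add]
      exact ha _ (Ideal.mem_sup_left (Ideal.pow_mem_frobeniusPower hx))
    rw [show a * (u * i) = u * (i * a) by ring]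
    exact hau _ (Ideal.mem_sup_left (Ideal.mul_mem_mul hi haL))
  have hwn : ∀ r ∈ n.frobeniusPower p e,
      r * w ^ p ^ e ∈ (maximalIdeal R).frobeniusPower p (e + E') := by
    have : n.frobeniusPower p e ≤ Submodule.comap (LinearMap.mulRight R (w ^ p ^ e))
        ((maximalIdeal R).frobeniusPower p (e + E')) := by
      refine Ideal.frobeniusPower_le_iff.2 fun x hx => ?_
      rw [Submodule.mem_comap, LinearMap.mulRight_apply, ← mul_pow, mul_comm x,
        Ideal.frobeniusPower_add]
      exact Ideal.pow_mem_frobeniusPower (hw x hx)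
    exact fun r hr => this hr
  have h2 : u * d * w ^ p ^ e ∈ (maximalIdeal R).frobeniusPower p (e + E') := by
    obtain ⟨x, hx, z, hz, rfl⟩ := Submodule.mem_sup.1 (hu u h1)
    rw [add_mul, add_mul]
    refine Ideal.add_mem _ (hwn _ (hc (Ideal.mul_mem_mul hx hd))) ?_
    exact Ideal.mul_mem_right _ _ (Ideal.mul_mem_right _ _ hz)
  rw [mul_pow, show u * (d * (w ^ p ^ e * Y ^ p ^ e)) = Y ^ p ^ e * (u * d * w ^ p ^ e) by ring]
  exact hY _ h2

theorem testIdeal_quotient_le_map_testIdeal (hR : IsFFinite R p) (I : Ideal R) [I.IsPrime]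
    (hI : I ≠ ⊥) {k : ℕ} (a : Fin k → Ideal R) (t : Fin k → ℝ) {s : ℝ} (hs0 : 0 < s)
    (hs1 : s < 1) :
    testIdeal p (fun i => (a i).map (Ideal.Quotient.mk I)) t ≤
      (testIdeal p (Fin.cons I a : Fin (k + 1) → Ideal R)
        (Fin.cons s t : Fin (k + 1) → ℝ)).map (Ideal.Quotient.mk I) := by
  intro x hx
  obtain ⟨x, rfl⟩ := Ideal.Quotient.mk_surjective x
  set n := testIdeal p (Fin.cons I a : Fin (k + 1) → Ideal R) (Fin.cons s t : Fin (k + 1) → ℝ)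
    with hn
  by_contra hxn
  have hxJ : x ∉ n ⊔ I := by
    intro h
    refine hxn ?_
    obtain ⟨y, hy, i, hi, rfl⟩ := Submodule.mem_sup.1 h
    rw [map_add, Ideal.Quotient.eq_zero_iff_mem.2 hi, add_zero]
    exact Ideal.mem_map_of_mem _ hy
  obtain ⟨E', hE'⟩ := IsLocalRing.exists_notMem_sup_pow hxJ
  have hZ'le : (maximalIdeal R).frobeniusPower p E' ≤ maximalIdeal R ^ E' :=
    (Ideal.frobeniusPower_le_pow E' _).trans
      (Ideal.pow_le_pow_right (Nat.lt_pow_self (Fact.out : p.Prime).one_lt).le)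
  have hxJ' : x ∉ (n ⊔ I) ⊔ (maximalIdeal R).frobeniusPower p E' :=
    fun h => hE' (sup_le_sup le_rfl hZ'le h)
  obtain ⟨w, hwJ, hwx⟩ : ∃ w, (∀ j ∈ (n ⊔ I) ⊔ (maximalIdeal R).frobeniusPower p E',
      w * j ∈ (maximalIdeal R).frobeniusPower p E') ∧
      w * x ∉ (maximalIdeal R).frobeniusPower p E' := by
    by_contra! h
    exact hxJ' (IsRegularLocalRing.mem_of_forall_mul_mem_frobeniusPower E' le_sup_right h)
  obtain ⟨E, hEE', e₀, hE⟩ := Ideal.exists_mem_pow_ceil_sup_of_mul_mem hR hI hs0 hs1 E'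
  obtain ⟨Y, hYinj, hYmul⟩ := IsRegularLocalRing.exists_mul_mem_frobeniusPower_iff R p hEE'
  set Z := (maximalIdeal R).frobeniusPower p E with hZ
  let L : Ideal R :=
    { carrier := {v | ∀ i ∈ I, v * i ∈ Z}
      zero_mem' := fun i _ => by simp
      add_mem' := fun hv hv' i hi => by rw [add_mul]; exact Z.add_mem (hv i hi) (hv' i hi)
      smul_mem' := fun r v hv i hi => by
        rw [smul_eq_mul, mul_assoc]; exact Z.mul_mem_left _ (hv i hi) }
  have hW : w * Y ∈ L := by
    intro i hi
    have h1 := hYmul 0 (w * i) (by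
      rw [zero_add]; exact hwJ i (Ideal.mem_sup_left (Ideal.mem_sup_right hi)))
    rw [zero_add, pow_zero, pow_one] at h1
    rwa [show w * Y * i = Y * (w * i) by ring]
  let M := Submodule.torsionBySet R (R ⧸ Z) I
  let z : M := ⟨Ideal.Quotient.mk Z (w * Y), mk_mem_torsionBySet hW⟩
  have : Module.Finite (R ⧸ I) M := Module.Finite.of_restrictScalars_finite R (R ⧸ I) M
  have hz : z ∈ tightClosure p (fun i => (a i).map (Ideal.Quotient.mk I)) t
      (⊥ : Submodule (R ⧸ I) M) := by
    -- The multiplier can be `1`: the vanishing is exact for every `e ≥ e₀`.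
    refine ⟨1, fun P hP h => hP.1.1.ne_top ((Ideal.eq_top_iff_one P).2 h), e₀, ?_⟩
    intro e he d hd
    have hd' : d ∈ (∏ i, a i ^ ⌈t i * (p : ℝ) ^ e⌉₊).map (Ideal.Quotient.mk I) := by
      have h1 := map_prod (Ideal.mapHom (Ideal.Quotient.mk I))
        (fun i => a i ^ ⌈t i * (p : ℝ) ^ e⌉₊) Finset.univ
      simp only [Ideal.mapHom_apply, Ideal.map_pow] at h1
      rwa [h1]
    obtain ⟨d, hdc, rfl⟩ := (Ideal.mem_map_iff_of_surjective _ Ideal.Quotient.mk_surjective).1 hd'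
    rw [Submodule.baseChange_bot, Submodule.mem_bot, one_mul]
    have hfree := FrobeniusTwist.free p hR e
    refine FrobeniusTwist.mk_tmul_eq_zero e (L := L) (fun v hv => hv)
      (fun v hv i _ => Z.mul_mem_right _ hv) hW ?_
    refine mul_pow_mem_of_le_frobeniusPower hR (n := n) (L := L) ?_ (hE e he)
      (fun j hj => hwJ j (Ideal.mem_sup_left (Ideal.mem_sup_left hj))) (hYmul e)
      (fun v hv => hv) hdc
    have := prod_pow_ceil_le_frobeniusPower_testIdeal hR (Fin.cons I a : Fin (k + 1) → Ideal R)
      (Fin.cons s t : Fin (k + 1) → ℝ) e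
    rw [Fin.prod_univ_succ] at this
    simpa only [Fin.cons_zero, Fin.cons_succ] using this
  have hxz : Ideal.Quotient.mk I x • z = 0 := by
    rw [testIdeal] at hx
    simp only [Submodule.mem_iInf, Submodule.mem_annihilator] at hx
    exact hx M _ _ this z hz
  have h0 : Ideal.Quotient.mk Z (x * (w * Y)) = 0 := congrArg Subtype.val hxz
  rw [Ideal.Quotient.eq_zero_iff_mem] at h0
  refine hwx (hYinj _ ?_)
  rwa [show Y * (w * x) = x * (w * Y) by ring]

end Restriction

theorem corollary3p13 {R : Type u} [CommRing R] [IsRegularLocalRing R]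
    (p : ℕ) [Fact p.Prime] [CharP R p] (hR : IsFFinite R p)
    (I : Ideal R) [I.IsPrime] (hI : I ≠ ⊥)
    [IsIntegrallyClosed (R ⧸ I)] (hS : IsQGorensteinQuotient I)
    {k : ℕ} (a : Fin k → Ideal R) (t : Fin k → ℝ) (ht : ∀ i, 0 < t i)
    (s : ℝ) (hs0 : 0 < s) (hs1 : s < 1) :
    testIdeal p (fun i => (a i).map (Ideal.Quotient.mk I)) t ≤
      (testIdeal p (Fin.cons I a : Fin (k + 1) → Ideal R)
        (Fin.cons s t : Fin (k + 1) → ℝ)).map (Ideal.Quotient.mk I) :=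
  testIdeal_quotient_le_map_testIdeal hR I hI a t hs0 hs1
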